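/- Let $d\ge 1$, let $\Omega=\{x\in\mathbb R^d: |x|>1\}$, and let $V:\Omega\to\mathbb R$ be measurable, bounded and positive. Let $H=-\Delta-V$ be the self-adjoint operator in $L^2(\Omega)$ with the Neumann boundary condition on the unit sphere, i.e. the operator associated with the closed form $\int_\Omega(|\nabla u|^2-V|u|^2)\,dx$ on $W^{1,2}(\Omega)$. Assume that the negative spectrum of $H$ consists of discrete eigenvalues: each negative point of the spectrum is an eigenvalue of finite multiplicity and an isolated point of the spectrum. Let $\lambda_n$ be the negative eigenvalues, repeated according to multiplicity, and let $\lambda_0$ be the lowest of them (with $\lambda_0=0$ if there are none). (i) For every $p$ with $0<p\le 1/2$ there is a constant $C$ depending only on $d$ and $p$ such that, for all such $V$, $$\int_{|x|>1}|V(x)|^{1/2+p}\,|x|^{1-d}\,dx\le C\Bigl(1+\sum_n|\lambda_n|^p\Bigr).$$ (ii) For every $p\ge 1/2$ there is a constant $C_{\lambda_0}$ depending only on $d$, $p$ and $\lambda_0$ such that, for all such $V$, $$\sum_{n=1}^\infty\Bigl(\int_{n<|x|\le n+1}V(x)\,|x|^{1-d}\,dx\Bigr)^{2p}\le C_{\lambda_0}\Bigl(1+\sum_n|\lambda_n|^p\Bigr).$$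 In both estimates the right-hand side is allowed to be $+\infty$; when $\sum_n|\lambda_n|^p$ is finite, the left-hand side is finite. -/

import Mathlib

open MeasureTheory
open scoped ENNReal NNReal ContDiff

namespace ExteriorNeumann

/-! ### Spectral notions for unbounded operators on a complex normed space -/

section Spectral

variable {E : Type*} [NormedAddCommGroup E] [NormedSpace ℂ E]

/-- The resolvent set of an unbounded operator `A`: those `z` for which `A - z` maps the domain
of `A` bijectively onto the whole space, with a bounded inverse `R`. -/
def resolventSet (A : E →ₗ.[ℂ] E) : Set ℂ :=
  {z | ∃ R : E →L[ℂ] E,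
    (∀ f : E, ∃ h : R f ∈ A.domain, A ⟨R f, h⟩ - z • R f = f) ∧
    ∀ u : A.domain, R (A u - z • (u : E)) = u}

/-- The spectrum of an unbounded operator. -/
def spectrum (A : E →ₗ.[ℂ] E) : Set ℂ := (resolventSet A)ᶜ

/-- The kernel of `A - z`, as a subspace of the ambient space. -/
def eigenspace (A : E →ₗ.[ℂ] E) (z : ℂ) : Submodule ℂ E :=
  (LinearMap.ker (A.toFun - z • A.domain.subtype)).map A.domain.subtype

/-- The negative part of the spectrum. -/
def negSpectrum (A : E →ₗ.[ℂ] E) : Set ℝ := {t | t < 0 ∧ (t : ℂ) ∈ spectrum A}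

/-- The negative spectrum consists of discrete eigenvalues: each of its points is an eigenvalue
of finite multiplicity and an isolated point of the spectrum. (Accumulation of eigenvalues
at `0` is allowed.) -/
def HasDiscreteNegSpectrum (A : E →ₗ.[ℂ] E) : Prop :=
  ∀ t ∈ negSpectrum A, eigenspace A t ≠ ⊥ ∧ FiniteDimensional ℂ (eigenspace A t) ∧
    ∃ ε : ℝ, 0 < ε ∧ ∀ z ∈ spectrum A, z ≠ t → ε ≤ ‖z - t‖

/-- `∑ₙ |λₙ| ^ p` over the negative eigenvalues, repeated according to multiplicity. The value
`∞` is allowed. -/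
noncomputable def negEigenvalueSum (A : E →ₗ.[ℂ] E) (p : ℝ) : ℝ≥0∞ :=
  ∑' t : negSpectrum A,
    (Module.finrank ℂ (eigenspace A (t : ℝ)) : ℝ≥0∞) * ENNReal.ofReal (|(t : ℝ)| ^ p)

/-- The lowest negative eigenvalue, and `0` if the negative spectrum is empty. -/
noncomputable def lowestEigenvalue (A : E →ₗ.[ℂ] E) : ℝ := sInf (insert 0 (negSpectrum A))

end Spectral

/-! ### The exterior of the unit ball and its Sobolev space -/

/-- The exterior domain `{x ∈ ℝᵈ : |x| > 1}`. -/
def exterior (d : ℕ) : Set (EuclideanSpace ℝ (Fin d)) := {x | 1 < ‖x‖}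

/-- Lebesgue measure on the exterior domain. -/
noncomputable abbrev extMeasure (d : ℕ) : Measure (EuclideanSpace ℝ (Fin d)) :=
  volume.restrict (exterior d)

/-- The complex Hilbert space `L²({|x| > 1})`. -/
noncomputable abbrev L2 (d : ℕ) := Lp ℂ 2 (extMeasure d)

/-- Real-valued test functions `φ ∈ C_c^∞({|x| > 1})`. -/
structure IsTest {d : ℕ} (φ : EuclideanSpace ℝ (Fin d) → ℝ) : Prop where
  contDiff : ContDiff ℝ ∞ φ
  hasCompactSupport : HasCompactSupport φ
  tsupport_subset : tsupport φ ⊆ exterior d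

/-- The classical partial derivative `∂ᵢ φ`. -/
noncomputable def partialDeriv {d : ℕ} (i : Fin d) (φ : EuclideanSpace ℝ (Fin d) → ℝ)
    (x : EuclideanSpace ℝ (Fin d)) : ℝ :=
  fderiv ℝ φ x (EuclideanSpace.single i 1)

/-- `G` is the weak gradient of `u` on `{|x| > 1}`; thus `u ∈ W^{1,2}({|x| > 1})` exactly when
some `G` with square integrable components has this property. -/
def HasWeakGradient {d : ℕ} (u : L2 d) (G : Fin d → L2 d) : Prop :=
  ∀ i : Fin d, ∀ φ : EuclideanSpace ℝ (Fin d) → ℝ, IsTest φ →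
    ∫ x, partialDeriv i φ x • u x ∂(extMeasure d) = - ∫ x, φ x • G i x ∂(extMeasure d)

section TestFunctions

variable {d : ℕ}

theorem isOpen_exterior : IsOpen (exterior d) := isOpen_lt continuous_const continuous_norm

theorem IsTest.continuous_partialDeriv {φ : EuclideanSpace ℝ (Fin d) → ℝ} (h : IsTest φ)
    (i : Fin d) : Continuous (partialDeriv i φ) :=
  (h.contDiff.continuous_fderiv (by simp)).clm_apply continuous_const

theorem IsTest.hasCompactSupport_partialDeriv {φ : EuclideanSpace ℝ (Fin d) → ℝ}
    (h : IsTest φ) (i : Fin d) : HasCompactSupport (partialDeriv i φ) :=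
  h.hasCompactSupport.fderiv_apply (𝕜 := ℝ) _

theorem integrable_smul_L2 {ψ : EuclideanSpace ℝ (Fin d) → ℝ} (hc : Continuous ψ)
    (hs : HasCompactSupport ψ) (u : L2 d) :
    Integrable (fun x => ψ x • u x) (extMeasure d) :=
  memLp_one_iff_integrable.1
    ((Lp.memLp u).smul (r := 1) (hc.memLp_of_hasCompactSupport (p := 2) hs))

theorem HasWeakGradient.zero : HasWeakGradient (0 : L2 d) 0 := by
  intro i φ _
  have h : ∀ ψ : EuclideanSpace ℝ (Fin d) → ℝ,
      ∫ x, ψ x • (0 : L2 d) x ∂(extMeasure d) = 0 := by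
    intro ψ
    refine integral_eq_zero_of_ae ?_
    filter_upwards [Lp.coeFn_zero ℂ 2 (extMeasure d)] with x hx
    rw [hx, Pi.zero_apply, smul_zero]
  rw [h, Pi.zero_apply, h, neg_zero]

theorem HasWeakGradient.add {u v : L2 d} {G K : Fin d → L2 d} (hu : HasWeakGradient u G)
    (hv : HasWeakGradient v K) : HasWeakGradient (u + v) (G + K) := by
  intro i φ hφ
  have h : ∀ (ψ : EuclideanSpace ℝ (Fin d) → ℝ) (a b : L2 d), Continuous ψ →
      HasCompactSupport ψ → ∫ x, ψ x • (a + b : L2 d) x ∂(extMeasure d) =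
        ∫ x, ψ x • a x ∂(extMeasure d) + ∫ x, ψ x • b x ∂(extMeasure d) := by
    intro ψ a b hc hs
    rw [← integral_add (integrable_smul_L2 hc hs a) (integrable_smul_L2 hc hs b)]
    refine integral_congr_ae ?_
    filter_upwards [Lp.coeFn_add a b] with x hx
    rw [hx, Pi.add_apply, smul_add]
  rw [h _ _ _ (hφ.continuous_partialDeriv i) (hφ.hasCompactSupport_partialDeriv i),
    Pi.add_apply, h _ _ _ hφ.contDiff.continuous hφ.hasCompactSupport, hu i φ hφ, hv i φ hφ]
  ring

theorem HasWeakGradient.smul {u : L2 d} {G : Fin d → L2 d} (c : ℂ) (hu : HasWeakGradient u G) :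
    HasWeakGradient (c • u) (c • G) := by
  intro i φ hφ
  have h : ∀ (ψ : EuclideanSpace ℝ (Fin d) → ℝ) (a : L2 d),
      ∫ x, ψ x • (c • a : L2 d) x ∂(extMeasure d) = c * ∫ x, ψ x • a x ∂(extMeasure d) := by
    intro ψ a
    rw [← smul_eq_mul, ← integral_smul]
    refine integral_congr_ae ?_
    filter_upwards [Lp.coeFn_smul c a] with x hx
    rw [hx, Pi.smul_apply, smul_comm]
  rw [h, Pi.smul_apply, h, hu i φ hφ]
  ring

/-- The fundamental lemma of the calculus of variations on the exterior domain. -/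
theorem eq_zero_of_integral_test (g : L2 d)
    (h : ∀ φ : EuclideanSpace ℝ (Fin d) → ℝ, IsTest φ →
      ∫ x, φ x • g x ∂(extMeasure d) = 0) : g = 0 := by
  have hloc : LocallyIntegrableOn g (exterior d) volume :=
    locallyIntegrableOn_of_locallyIntegrable_restrict
      ((Lp.memLp g).locallyIntegrable (by norm_num))
  have := isOpen_exterior.ae_eq_zero_of_integral_contDiff_smul_eq_zero hloc (by
    intro φ h1 h2 h3
    rw [← h φ ⟨h1, h2, h3⟩]
    refine (setIntegral_eq_integral_of_forall_compl_eq_zero fun x hx => ?_).symm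
    rw [image_eq_zero_of_notMem_tsupport fun h' => hx (h3 h'), zero_smul])
  refine Lp.ext ?_
  have h2 : ∀ᵐ x ∂(extMeasure d), g x = 0 :=
    (ae_restrict_iff' isOpen_exterior.measurableSet).2 this
  filter_upwards [h2, Lp.coeFn_zero ℂ 2 (extMeasure d)] with x hx h0
  rw [hx, h0, Pi.zero_apply]

theorem memLp_test {ψ : EuclideanSpace ℝ (Fin d) → ℝ} (hc : Continuous ψ)
    (hs : HasCompactSupport ψ) : MemLp (fun x => (ψ x : ℂ)) 2 (extMeasure d) :=
  (Complex.continuous_ofReal.comp hc).memLp_of_hasCompactSupport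
    (hs.comp_left Complex.ofReal_zero)

/-- A test function belongs to `W^{1,2}`, with its classical gradient. -/
theorem IsTest.hasWeakGradient {φ : EuclideanSpace ℝ (Fin d) → ℝ} (h : IsTest φ) :
    HasWeakGradient (memLp_test h.contDiff.continuous h.hasCompactSupport).toLp
      (fun i => (memLp_test (h.continuous_partialDeriv i)
        (h.hasCompactSupport_partialDeriv i)).toLp) := by
  intro i ψ hψ
  have h1 : ∫ x, φ x * partialDeriv i ψ x = - ∫ x, partialDeriv i φ x * ψ x := by
    refine integral_mul_fderiv_eq_neg_fderiv_mul_of_integrable ?_ ?_ ?_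
      (fun x _ => h.contDiff.differentiable (by simp) x)
      (fun x _ => hψ.contDiff.differentiable (by simp) x)
    · exact ((h.continuous_partialDeriv i).mul
        hψ.contDiff.continuous).integrable_of_hasCompactSupport hψ.hasCompactSupport.mul_left
    · exact (h.contDiff.continuous.mul
        (hψ.continuous_partialDeriv i)).integrable_of_hasCompactSupport h.hasCompactSupport.mul_right
    · exact (h.contDiff.continuous.mul
        hψ.contDiff.continuous).integrable_of_hasCompactSupport h.hasCompactSupport.mul_right
  have h2 : ∫ x, φ x * partialDeriv i ψ x ∂(extMeasure d) = ∫ x, φ x * partialDeriv i ψ x :=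
    setIntegral_eq_integral_of_forall_compl_eq_zero fun x hx => by
      rw [image_eq_zero_of_notMem_tsupport fun h' => hx (h.tsupport_subset h'), zero_mul]
  have h3 : ∫ x, partialDeriv i φ x * ψ x ∂(extMeasure d) = ∫ x, partialDeriv i φ x * ψ x :=
    setIntegral_eq_integral_of_forall_compl_eq_zero fun x hx => by
      rw [image_eq_zero_of_notMem_tsupport fun h' => hx (hψ.tsupport_subset h'), mul_zero]
  rw [← h2, ← h3] at h1
  have h4 := congrArg Complex.ofReal h1
  rw [Complex.ofReal_neg, ← integral_complex_ofReal, ← integral_complex_ofReal] at h4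
  convert h4 using 1
  · refine integral_congr_ae ?_
    filter_upwards [(memLp_test h.contDiff.continuous h.hasCompactSupport).coeFn_toLp] with x hx
    rw [hx]
    simp [mul_comm]
  · refine congrArg Neg.neg (integral_congr_ae ?_)
    filter_upwards [(memLp_test (h.continuous_partialDeriv i)
      (h.hasCompactSupport_partialDeriv i)).coeFn_toLp] with x hx
    rw [hx]
    simp [mul_comm]

end TestFunctions

/-! ### The Neumann Laplacian and the Schrödinger operator -/

/-- The graph of the Neumann Laplacian `-Δ` on `{|x| > 1}`, that is, of the self-adjoint operator
associated with the closed form `∫ ∇u · conj ∇v` on `W^{1,2}({|x| > 1})`: a pair `(u, f)` belongs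
to it when `u ∈ W^{1,2}` and `∫ ∇u · conj ∇v = ∫ f conj v` for all `v ∈ W^{1,2}`. As `v` is not
required to vanish at `|x| = 1`, this contains the boundary condition `∂u/∂n = 0`. -/
def neumannLaplacianGraph (d : ℕ) : Submodule ℂ (L2 d × L2 d) where
  carrier := {q | ∃ G : Fin d → L2 d, HasWeakGradient q.1 G ∧
    ∀ (v : L2 d) (K : Fin d → L2 d), HasWeakGradient v K →
      ∑ i, inner ℂ (K i) (G i) = inner ℂ v q.2}
  zero_mem' := ⟨0, HasWeakGradient.zero, fun v K _ => by simp⟩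
  add_mem' := by
    rintro a b ⟨G, hG, hG'⟩ ⟨K, hK, hK'⟩
    refine ⟨G + K, hG.add hK, fun v L hL => ?_⟩
    simp [inner_add_right, Finset.sum_add_distrib, hG' v L hL, hK' v L hL]
  smul_mem' := by
    rintro c a ⟨G, hG, hG'⟩
    refine ⟨c • G, hG.smul c, fun v L hL => ?_⟩
    simp [inner_smul_right, ← Finset.mul_sum, hG' v L hL]

/-- The Neumann Laplacian is single valued. -/
theorem neumannLaplacianGraph_snd_eq_zero (d : ℕ) (q : L2 d × L2 d)
    (hq : q ∈ neumannLaplacianGraph d) (h0 : q.1 = 0) : q.2 = 0 := by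
  obtain ⟨G, hG, hG'⟩ := hq
  have hG0 : G = 0 := by
    funext i
    refine eq_zero_of_integral_test _ fun φ hφ => ?_
    have h1 := hG i φ hφ
    rw [h0, HasWeakGradient.zero i φ hφ] at h1
    have h2 : ∫ x, φ x • (0 : Fin d → L2 d) i x ∂(extMeasure d) = 0 := by
      refine integral_eq_zero_of_ae ?_
      filter_upwards [Lp.coeFn_zero ℂ 2 (extMeasure d)] with x hx
      rw [Pi.zero_apply, hx, Pi.zero_apply, smul_zero]
    rw [h2] at h1
    simpa using h1.symm
  refine eq_zero_of_integral_test _ fun φ hφ => ?_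
  have h1 := hG' _ _ hφ.hasWeakGradient
  rw [hG0, L2.inner_def] at h1
  simp only [Pi.zero_apply, inner_zero_right, Finset.sum_const_zero] at h1
  rw [h1]
  refine integral_congr_ae ?_
  filter_upwards [(memLp_test hφ.contDiff.continuous hφ.hasCompactSupport).coeFn_toLp] with x hx
  rw [hx]
  simp [mul_comm]

/-- The Neumann Laplacian `-Δ` in `L²({|x| > 1})`. -/
noncomputable def neumannLaplacian (d : ℕ) : L2 d →ₗ.[ℂ] L2 d :=
  (neumannLaplacianGraph d).toLinearPMap

theorem neumannLaplacian_graph (d : ℕ) :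
    (neumannLaplacian d).graph = neumannLaplacianGraph d :=
  Submodule.toLinearPMap_graph_eq _ (neumannLaplacianGraph_snd_eq_zero d)

/-- Multiplication by the real function `V`, on its maximal domain. (For bounded measurable `V`
this is everywhere defined.) -/
noncomputable def mulOp (d : ℕ) (V : EuclideanSpace ℝ (Fin d) → ℝ) : L2 d →ₗ.[ℂ] L2 d where
  domain :=
    { carrier := {u | MemLp (fun x => V x • u x) 2 (extMeasure d)}
      zero_mem' := (memLp_congr_ae (by
        filter_upwards [Lp.coeFn_zero ℂ 2 (extMeasure d)] with x hx
        rw [hx, Pi.zero_apply, smul_zero])).2 (MemLp.zero (ε := ℂ))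
      add_mem' := fun {a b} ha hb => (memLp_congr_ae (by
        filter_upwards [Lp.coeFn_add a b] with x hx
        rw [hx, Pi.add_apply, smul_add]; rfl)).2 (MemLp.add ha hb)
      smul_mem' := fun c a ha => (memLp_congr_ae (by
        filter_upwards [Lp.coeFn_smul c a] with x hx
        rw [hx, Pi.smul_apply, smul_comm]; rfl)).2 (MemLp.const_smul ha c) }
  toFun :=
    { toFun := fun u => MemLp.toLp (fun x => V x • u.1 x) u.2
      map_add' := fun a b => by
        rw [← MemLp.toLp_add]
        refine MemLp.toLp_congr _ _ ?_
        filter_upwards [Lp.coeFn_add a.1 b.1] with x hx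
        exact (congrArg (V x • ·) hx).trans (smul_add _ _ _)
      map_smul' := fun c a => by
        rw [RingHom.id_apply, ← MemLp.toLp_const_smul]
        refine MemLp.toLp_congr _ _ ?_
        filter_upwards [Lp.coeFn_smul c a.1] with x hx
        exact (congrArg (V x • ·) hx).trans (smul_comm (V x) c (a.1 x)) }

/-- The Schrödinger operator `H = -Δ - V` in `L²({|x| > 1})` with the Neumann condition on the
unit sphere. -/
noncomputable def schrodinger (d : ℕ) (V : EuclideanSpace ℝ (Fin d) → ℝ) : L2 d →ₗ.[ℂ] L2 d :=
  neumannLaplacian d - mulOp d V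

/-- The potentials under consideration: `V` is measurable, positive and bounded on `{|x| > 1}`
(almost everywhere), and the negative spectrum of `-Δ - V` consists of discrete eigenvalues. -/
structure IsAdmissible (d : ℕ) (V : EuclideanSpace ℝ (Fin d) → ℝ) : Prop where
  aemeasurable : AEMeasurable V (extMeasure d)
  pos : ∀ᵐ x ∂(extMeasure d), 0 < V x
  bounded : ∃ M : ℝ, ∀ᵐ x ∂(extMeasure d), V x ≤ M
  discrete : HasDiscreteNegSpectrum (schrodinger d V)

end ExteriorNeumann

/-!
The theorem bounds the potential by the eigenvalues, so eigenvalues have to be produced by test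
functions. These are radial, and only the mass `m(a, b) = ∫_{a<|x|≤b} V |x|^{1-d} dx` matters
(`mass`). If the annulus `a < |x| ≤ a + l` has `l ≤ a` and `l m(a, a + l)` is a large enough
constant `c`, then a trapezoidal function of slope `K / l` which is `1` on the annulus has a
quotient of form and squared norm of at most `-l⁻²`, as all weights `|x|^{d-1}` on its support are
comparable to `a^{d-1}` (`bumpElement_le`).

Cut `(1, ∞)` greedily into intervals of lengths `lₙ` which are critical, `lₙ m = c`, or as long as
their left endpoint (`exists_criticalPartition`). The long ones contribute a geometric series to
`∑ lₙ^{-2p}`. A critical interval which is at most `K` times as long as both of its neighbours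
carries a trapezoid supported by the interval and its neighbours; every third of these have
disjoint supports, and so these intervals contribute at most three times the eigenvalue moment. For
any other interval, `lₙ^{-2p}` is at most a quarter of the same quantity at a neighbour, where `K`
is chosen as `2^{1/p}`, and such terms can be absorbed (`tsum_le_two_mul_of_neighbours`). Hence
`∑ lₙ^{-2p} ≤ C (1 + ∑ |λₙ|^p)`, which is `IsCriticalPartition.tsum_length_le`.

For the first estimate, Hölder's inequality bounds the integral over each annulus of the partition
by `C lₙ^{-2p}`. For the second one, the mass of an interval of the partition is at most `c / lₙ`,
and superadditivity of `t ↦ t^{2p}` passes to the unit intervals, provided that a unit interval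
meets a bounded number of intervals of the partition. The latter holds because a trapezoid on a
unit interval bounds its mass in terms of the lowest eigenvalue (`mass_unit_le`).

The spectral input is Glazman's lemma (`IsFormOperator.card_le_sum_finrank`): `n` orthogonal
vectors, also orthogonal for the form, on which the form is at most `-κ`, force `n` eigenvalues at
or below `-κ`. No spectral theorem for unbounded operators is needed. The discreteness hypothesis
puts any negative `s` below the form bound into the resolvent set, and the functional calculus of
the bounded self-adjoint operator `R = (A - s)⁻¹` provides a projection whose range is spanned by the
eigenvectors at or below `-κ`. On its kernel `R` is small, hence the form is greater than `-κ` by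
the Cauchy–Schwarz inequality (`IsFormOperator.form_ge`), so the projection is injective on the span
of the vectors.
-/

namespace ExteriorNeumann

/-! ### Spectral cutoffs of bounded self-adjoint operators -/

section Bounded

variable {E : Type*} [NormedAddCommGroup E] [InnerProductSpace ℂ E] [CompleteSpace E]

/-- A set which is finite above `τ` and has a gap below `τ` is discrete there, so that every
function vanishing below `τ` is continuous on it. -/
theorem continuousOn_of_finite_above {s : Set ℝ} {σ τ : ℝ} (hστ : σ < τ)
    (hgap : ∀ x ∈ s, x < τ → x ≤ σ) (hfin : {x ∈ s | τ ≤ x}.Finite) {g : ℝ → ℝ}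
    (hg : ∀ x < τ, g x = 0) : ContinuousOn g s := by
  intro x hx
  rcases lt_or_ge x τ with h | h
  · have : ∀ᶠ y in nhds x, g y = g x := by
      filter_upwards [Iio_mem_nhds h] with y hy
      rw [hg y hy, hg x h]
    exact (continuousAt_const.congr (this.mono fun y hy => hy.symm)).continuousWithinAt
  · have h1 : ({x' ∈ s | τ ≤ x'} \ {x})ᶜ ∈ nhds x :=
      (hfin.subset Set.sdiff_subset).isClosed.isOpen_compl.mem_nhds (by simp)
    have : ∀ᶠ y in nhdsWithin x s, g y = g x := by
      filter_upwards [mem_nhdsWithin_of_mem_nhds h1, self_mem_nhdsWithin,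
        mem_nhdsWithin_of_mem_nhds (Ioi_mem_nhds (hστ.trans_le h))] with y hy hys hyσ
      have hy' : τ ≤ y := by
        by_contra! hc
        exact absurd (hgap y hys hc) (not_le.2 hyσ)
      have : y = x := by
        by_contra hne
        exact hy ⟨⟨hys, hy'⟩, hne⟩
      rw [this]
    exact (continuousWithinAt_const (b := g x)).congr_of_eventuallyEq this rfl

/-- The spectral projection of a bounded self-adjoint operator onto the part of its spectrum
above `τ`, when that part is finite and separated from the rest by the gap `(σ, τ)`. -/
theorem exists_spectral_cutoff (R : E →L[ℂ] E) (hR : IsSelfAdjoint R) {σ τ : ℝ} (hσ : 0 ≤ σ)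
    (hστ : σ < τ) (hgap : ∀ x ∈ _root_.spectrum ℝ R, x < τ → x ≤ σ)
    (hfin : {x ∈ _root_.spectrum ℝ R | τ ≤ x}.Finite) :
    ∃ P : E →L[ℂ] E, (∀ u, P u ∈ ⨆ μ ∈ hfin.toFinset, LinearMap.ker
        ((R : E →ₗ[ℂ] E) - (μ : ℂ) • LinearMap.id)) ∧
      ∀ u, P u = 0 → (inner ℂ u (R u)).re ≤ σ * ‖u‖ ^ 2 := by
  have hcont : ∀ g : ℝ → ℝ, (∀ x < τ, g x = 0) → ContinuousOn g (_root_.spectrum ℝ R) :=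
    fun g hg => continuousOn_of_finite_above hστ hgap hfin hg
  -- On the spectrum, the indicator function of `[τ, ∞)` is a finite sum of those of points.
  let e : ℝ → ℝ → ℝ := fun μ => Set.indicator {μ} 1
  have he : ∀ μ ∈ hfin.toFinset, ContinuousOn (e μ) (_root_.spectrum ℝ R) := by
    intro μ hμ
    refine hcont _ fun x hx => Set.indicator_of_notMem ?_ _
    have : τ ≤ μ := by simpa using ((Set.Finite.mem_toFinset _).1 hμ).2
    simp only [Set.mem_singleton_iff]
    intro h
    linarith
  let f : ℝ → ℝ := Set.indicator (Set.Ici τ) 1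
  have hf : ContinuousOn f (_root_.spectrum ℝ R) :=
    hcont _ fun x hx => Set.indicator_of_notMem (by simpa using hx) _
  have hsum : cfc f R = ∑ μ ∈ hfin.toFinset, cfc (e μ) R := by
    rw [← cfc_sum _ _ _ he]
    refine cfc_congr fun x hx => ?_
    rw [Finset.sum_apply]
    by_cases h : τ ≤ x
    · rw [Finset.sum_eq_single x]
      · simp [f, e, h]
      · intro b _ hb
        simp [e, Ne.symm hb]
      · intro h'
        exact absurd ((Set.Finite.mem_toFinset hfin).2 ⟨hx, h⟩) h'
    · rw [Finset.sum_eq_zero]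
      · simp [f, h]
      · intro μ hμ
        have : τ ≤ μ := by simpa using ((Set.Finite.mem_toFinset _).1 hμ).2
        refine Set.indicator_of_notMem ?_ _
        simp only [Set.mem_singleton_iff]
        intro h
        linarith
  refine ⟨cfc f R, fun u => ?_, fun u hu => ?_⟩
  · rw [hsum, _root_.sum_apply]
    refine Submodule.sum_mem _ fun μ hμ => ?_
    refine Submodule.mem_iSup_of_mem μ (Submodule.mem_iSup_of_mem hμ ?_)
    have h1 : R * cfc (e μ) R = μ • cfc (e μ) R := by
      have h3 : cfc (fun x => x * e μ x) R = R * cfc (e μ) R := by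
        rw [cfc_mul (fun x => x) (e μ) R continuousOn_id (he μ hμ), cfc_id' ℝ R]
      rw [← cfc_const_mul _ _ _ (he μ hμ), ← h3]
      refine cfc_congr fun x _ => ?_
      by_cases h : x = μ
      · simp [h]
      · simp [e, h]
    have h2 : R (cfc (e μ) R u) = μ • cfc (e μ) R u := congrArg (fun S : E →L[ℂ] E => S u) h1
    rw [LinearMap.mem_ker, LinearMap.sub_apply, LinearMap.smul_apply, LinearMap.id_apply,
      ContinuousLinearMap.coe_coe, h2, Complex.coe_smul, sub_self]
  -- On the kernel of the projection `R` acts as `R - R f(R)`, which is at most `σ`.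
  · have h1 : cfc (fun x => x - x * f x) R = R - R * cfc f R := by
      rw [cfc_sub (fun x => x) (fun x => x * f x) R continuousOn_id (continuousOn_id.mul hf),
        cfc_mul (fun x => x) f R continuousOn_id hf, cfc_id' ℝ R]
    have h2 : R - R * cfc f R ≤ algebraMap ℝ (E →L[ℂ] E) σ := by
      rw [← h1]
      refine cfc_le_algebraMap _ _ _ fun x hx => ?_
      by_cases h : τ ≤ x
      · simpa [f, h] using hσ
      · simpa [f, h] using hgap x hx (not_le.1 h)
    have h3 := ((ContinuousLinearMap.le_def _ _).1 h2).inner_nonneg_right u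
    have h4 : (algebraMap ℝ (E →L[ℂ] E) σ - (R - R * cfc f R)) u = (σ : ℂ) • u - R u := by
      simp [hu, Algebra.algebraMap_eq_smul_one]
    rw [h4, inner_sub_right, inner_smul_right, inner_self_eq_norm_sq_to_K] at h3
    have h5 := (Complex.le_def.1 h3).1
    have h6 : ((σ : ℂ) * (‖u‖ : ℂ) ^ 2) = ((σ * ‖u‖ ^ 2 : ℝ) : ℂ) := by push_cast; ring
    simp only [Complex.coe_algebraMap, h6, Complex.sub_re, Complex.zero_re, Complex.ofReal_re] at h5
    linarith

end Bounded

/-! ### The variational principle for operators with discrete negative spectrum -/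

section Form

variable {E : Type*} [NormedAddCommGroup E] [InnerProductSpace ℂ E]
  {W : Type*} [AddCommGroup W] [Module ℂ W]

/-- `A` acts as the operator of the hermitian form `q`, which is bounded below by `-M`. The form
domain is a vector space `W` with a linear map `j` into the Hilbert space. Only the inclusion of
`A` in the operator of the form is required. -/
structure IsFormOperator (A : E →ₗ.[ℂ] E) (j : W →ₗ[ℂ] E) (q : W →ₗ⋆[ℂ] W →ₗ[ℂ] ℂ) (M : ℝ) :
    Prop where
  symm : ∀ v w, star (q v w) = q w v
  lower : ∀ w, -M * ‖j w‖ ^ 2 ≤ (q w w).re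
  repr : ∀ u : A.domain, ∃ w, j w = u ∧ ∀ v, q v w = inner ℂ (j v) (A u)

theorem mem_eigenspace {A : E →ₗ.[ℂ] E} {z : ℂ} {v : E} :
    v ∈ eigenspace A z ↔ ∃ h : v ∈ A.domain, A ⟨v, h⟩ = z • v := by
  simp only [eigenspace, Submodule.mem_map, LinearMap.mem_ker, LinearMap.sub_apply,
    LinearMap.smul_apply, Submodule.subtype_apply, sub_eq_zero]
  constructor
  · rintro ⟨x, hx, rfl⟩
    exact ⟨x.2, hx⟩
  · rintro ⟨h, hx⟩
    exact ⟨⟨v, h⟩, hx, rfl⟩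

/-- `R` is the bounded inverse of `A - z`. -/
def IsResolvent (A : E →ₗ.[ℂ] E) (z : ℂ) (R : E →L[ℂ] E) : Prop :=
  (∀ f : E, ∃ h : R f ∈ A.domain, A ⟨R f, h⟩ - z • R f = f) ∧
    ∀ u : A.domain, R (A u - z • (u : E)) = u

variable {A : E →ₗ.[ℂ] E} {j : W →ₗ[ℂ] E} {q : W →ₗ⋆[ℂ] W →ₗ[ℂ] ℂ} {M : ℝ}

/-- Below the form bound there is no eigenvalue, hence, by discreteness, no spectrum. -/
theorem IsFormOperator.mem_resolventSet (h : IsFormOperator A j q M)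
    (hA : HasDiscreteNegSpectrum A) {s : ℝ} (hs : s < -M) (hs0 : s < 0) :
    (s : ℂ) ∈ resolventSet A := by
  by_contra hc
  obtain ⟨h1, -, -⟩ := hA s ⟨hs0, hc⟩
  obtain ⟨v, hv, hv0⟩ := Submodule.exists_mem_ne_zero_of_ne_bot h1
  obtain ⟨hd, hv⟩ := mem_eigenspace.1 hv
  obtain ⟨w, hw, hq⟩ := h.repr ⟨v, hd⟩
  have h2 := h.lower w
  have hw' : j w = v := hw
  rw [hq, hv, hw', inner_smul_right, inner_self_eq_norm_sq_to_K] at h2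
  have h6 : ((s : ℂ) * (‖v‖ : ℂ) ^ 2) = ((s * ‖v‖ ^ 2 : ℝ) : ℂ) := by push_cast; ring
  simp only [Complex.coe_algebraMap, h6, Complex.ofReal_re] at h2
  have : 0 < ‖v‖ ^ 2 := by positivity
  nlinarith

theorem IsFormOperator.repr_resolvent (h : IsFormOperator A j q M) {s : ℝ} {R : E →L[ℂ] E}
    (hR : IsResolvent A s R) (f : E) :
    ∃ w, j w = R f ∧ ∀ v, q v w - s * inner ℂ (j v) (j w) = inner ℂ (j v) f := by
  obtain ⟨hd, hf⟩ := hR.1 f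
  obtain ⟨w, hw, hq⟩ := h.repr ⟨R f, hd⟩
  have hw' : j w = R f := hw
  refine ⟨w, hw', fun v => ?_⟩
  rw [hq, hw', ← inner_smul_right, ← inner_sub_right, hf]

theorem IsFormOperator.isSelfAdjoint_resolvent [CompleteSpace E] (h : IsFormOperator A j q M)
    {s : ℝ} {R : E →L[ℂ] E} (hR : IsResolvent A s R) : IsSelfAdjoint R := by
  rw [ContinuousLinearMap.isSelfAdjoint_iff_isSymmetric]
  intro x y
  obtain ⟨w, hw, hqw⟩ := h.repr_resolvent hR x
  obtain ⟨v, hv, hqv⟩ := h.repr_resolvent hR y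
  change inner ℂ (R x) y = inner ℂ x (R y)
  rw [← hw, ← hv, ← hqv, ← inner_conj_symm x, ← hqw, map_sub, map_mul, inner_conj_symm,
    Complex.conj_ofReal]
  congr 1
  exact (h.symm v w).symm

/-- A bound from above on the resolvent at the vector `j w` bounds the form from below at `w`:
this is the Cauchy–Schwarz inequality for the nonnegative form `q - s`. -/
theorem IsFormOperator.form_ge (h : IsFormOperator A j q M) {s : ℝ} (hs : s ≤ -M)
    {R : E →L[ℂ] E} (hR : IsResolvent A s R) (w : W) {τ : ℝ} (hτ : 0 < τ)
    (hw : (inner ℂ (j w) (R (j w))).re ≤ τ * ‖j w‖ ^ 2) :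
    (s + τ⁻¹) * ‖j w‖ ^ 2 ≤ (q w w).re := by
  obtain ⟨w₀, hw₀, hq⟩ := h.repr_resolvent hR (j w)
  -- The nonnegative quadratic polynomial `t ↦ (q - s)(w - t w₀)` is evaluated at `t = τ⁻¹`.
  set x : W := w - (τ⁻¹ : ℂ) • w₀ with hx
  have h1 : 0 ≤ (q x x - s * inner ℂ (j x) (j x)).re := by
    have h2 := h.lower x
    have h3 : inner ℂ (j x) (j x) = ((‖j x‖ ^ 2 : ℝ) : ℂ) := by
      rw [inner_self_eq_norm_sq_to_K]; push_cast; rfl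
    rw [h3, ← Complex.ofReal_mul, Complex.sub_re, Complex.ofReal_re]
    nlinarith [sq_nonneg ‖j x‖]
  have hconj : q w₀ w - s * inner ℂ (j w₀) (j w) = star (inner ℂ (j w) (j w)) := by
    rw [← hq w, star_sub, h.symm, star_mul']
    congr 2
    · simp
    · exact (inner_conj_symm _ _).symm
  have hre : (inner ℂ (j w₀) (j w)).re = (inner ℂ (j w) (R (j w))).re := by
    rw [← inner_conj_symm, hw₀, Complex.conj_re]
  have hself : inner ℂ (j w) (j w) = ((‖j w‖ ^ 2 : ℝ) : ℂ) := by
    rw [inner_self_eq_norm_sq_to_K]; push_cast; rfl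
  have hexp : q x x - s * inner ℂ (j x) (j x) =
      (q w w - s * inner ℂ (j w) (j w)) - (τ⁻¹ : ℂ) * (q w w₀ - s * inner ℂ (j w) (j w₀))
        - (τ⁻¹ : ℂ) * (q w₀ w - s * inner ℂ (j w₀) (j w))
        + (τ⁻¹ : ℂ) ^ 2 * (q w₀ w₀ - s * inner ℂ (j w₀) (j w₀)) := by
    simp only [hx, map_sub, LinearMap.sub_apply, LinearMap.map_smulₛₗ, LinearMap.smul_apply,
      inner_sub_left, inner_sub_right, inner_smul_left, inner_smul_right, smul_eq_mul, map_inv₀,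
      Complex.conj_ofReal, RingHom.id_apply]
    ring
  rw [hexp, hq, hq, hconj, hself] at h1
  have h4 : ((τ⁻¹ : ℂ)) = ((τ⁻¹ : ℝ) : ℂ) := by push_cast; rfl
  have h5 : star (((‖j w‖ ^ 2 : ℝ) : ℂ)) = ((‖j w‖ ^ 2 : ℝ) : ℂ) := Complex.conj_ofReal _
  rw [h5, h4, ← Complex.ofReal_pow, ← Complex.ofReal_mul, ← Complex.ofReal_mul, Complex.add_re,
    Complex.sub_re, Complex.sub_re, Complex.re_ofReal_mul, Complex.sub_re, Complex.ofReal_re,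
    Complex.ofReal_re, hre] at h1
  have h6 : (τ⁻¹) ^ 2 * (inner ℂ (j w) (R (j w))).re ≤ τ⁻¹ * ‖j w‖ ^ 2 := by
    calc (τ⁻¹) ^ 2 * (inner ℂ (j w) (R (j w))).re ≤ (τ⁻¹) ^ 2 * (τ * ‖j w‖ ^ 2) := by gcongr
      _ = τ⁻¹ * ‖j w‖ ^ 2 := by field_simp
  linarith

/-- The spectral mapping `μ ↦ s + μ⁻¹` from the resolvent to the operator. -/
theorem mem_spectrum_of_mem_spectrum_resolvent {s : ℝ} {R : E →L[ℂ] E} (hR : IsResolvent A s R)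
    {μ : ℝ} (hμ0 : μ ≠ 0) (hμ : μ ∈ _root_.spectrum ℝ R) :
    ((s + μ⁻¹ : ℝ) : ℂ) ∈ spectrum A := by
  intro hc
  obtain ⟨R', hR'⟩ : ∃ R', IsResolvent A ((s + μ⁻¹ : ℝ) : ℂ) R' := hc
  refine hμ ?_
  have hz : ((s + μ⁻¹ : ℝ) : ℂ) = s + (μ : ℂ)⁻¹ := by push_cast; rfl
  rw [hz] at hR'
  have hμ' : (μ : ℂ) ≠ 0 := by exact_mod_cast hμ0
  have e1 : ∀ f, R f = R' f - (μ : ℂ)⁻¹ • R (R' f) := by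
    intro f
    obtain ⟨hd, hf⟩ := hR'.1 f
    have h1 := hR.2 ⟨R' f, hd⟩
    conv_lhs => rw [← hf]
    rw [add_smul, ← sub_sub, map_sub, h1, map_smul]
  have e2 : ∀ f, R' f = R f + (μ : ℂ)⁻¹ • R' (R f) := by
    intro f
    obtain ⟨hd, hf⟩ := hR.1 f
    have h1 := hR'.2 ⟨R f, hd⟩
    conv_lhs => rw [← hf]
    have : A ⟨R f, hd⟩ - (s : ℂ) • R f =
        (A ⟨R f, hd⟩ - ((s : ℂ) + (μ : ℂ)⁻¹) • R f) + (μ : ℂ)⁻¹ • R f := by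
      rw [add_smul]; abel
    rw [this, map_add, h1, map_smul]
  -- `(μ - x)⁻¹ = μ⁻¹ (1 + μ⁻¹ (a - s - μ⁻¹)⁻¹)` for `x = (a - s)⁻¹`.
  let B : E →L[ℂ] E := (μ : ℂ)⁻¹ • (1 + (μ : ℂ)⁻¹ • R')
  have hal : ∀ f, (algebraMap ℝ (E →L[ℂ] E) μ) f = (μ : ℂ) • f := by
    intro f
    simp [Algebra.algebraMap_eq_smul_one]
  refine ⟨⟨algebraMap ℝ (E →L[ℂ] E) μ - R, B, ?_, ?_⟩, rfl⟩
  · ext f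
    change (algebraMap ℝ (E →L[ℂ] E) μ) ((μ : ℂ)⁻¹ • (f + (μ : ℂ)⁻¹ • R' f)) -
      R ((μ : ℂ)⁻¹ • (f + (μ : ℂ)⁻¹ • R' f)) = f
    rw [hal, map_smul, map_add, map_smul, smul_inv_smul₀ hμ', e1 f]
    simp
  · ext f
    change (μ : ℂ)⁻¹ • (((algebraMap ℝ (E →L[ℂ] E) μ) f - R f) +
      (μ : ℂ)⁻¹ • R' ((algebraMap ℝ (E →L[ℂ] E) μ) f - R f)) = f
    rw [hal, map_sub, map_smul, smul_sub (μ : ℂ)⁻¹ (_ • _), inv_smul_smul₀ hμ', e2 f]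
    have : (μ : ℂ) • f - R f + (R f + (μ : ℂ)⁻¹ • R' (R f) - (μ : ℂ)⁻¹ • R' (R f)) =
      (μ : ℂ) • f := by abel
    rw [this, inv_smul_smul₀ hμ']

theorem mem_eigenspace_of_resolvent_eq {s : ℝ} {R : E →L[ℂ] E} (hR : IsResolvent A s R)
    {μ : ℝ} (hμ0 : μ ≠ 0) {v : E} (hv : R v = (μ : ℂ) • v) :
    v ∈ eigenspace A ((s + μ⁻¹ : ℝ) : ℂ) := by
  have hμ' : (μ : ℂ) ≠ 0 := by exact_mod_cast hμ0
  obtain ⟨hd, hf⟩ := hR.1 ((μ : ℂ)⁻¹ • v)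
  have h1 : R ((μ : ℂ)⁻¹ • v) = v := by rw [map_smul, hv, inv_smul_smul₀ hμ']
  have hd' : v ∈ A.domain := h1 ▸ hd
  refine mem_eigenspace.2 ⟨hd', ?_⟩
  have h2 : (⟨R ((μ : ℂ)⁻¹ • v), hd⟩ : A.domain) = ⟨v, hd'⟩ := Subtype.ext h1
  rw [h2, h1] at hf
  rw [sub_eq_iff_eq_add.1 hf]
  push_cast
  rw [add_smul, add_comm]

/-- Every point of the spectrum of the resolvent which corresponds to a negative point is
isolated. -/
theorem exists_isolating_radius [CompleteSpace E] (hA : HasDiscreteNegSpectrum A) {s : ℝ}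
    {R : E →L[ℂ] E} (hR : IsResolvent A s R) {μ : ℝ} (hμ : 0 < μ) (hneg : s + μ⁻¹ < 0) :
    ∃ δ > 0, ∀ x ∈ _root_.spectrum ℝ R, x ≠ μ → δ ≤ |x - μ| := by
  suffices h : ∀ᶠ x in nhds μ, x ∈ _root_.spectrum ℝ R → x = μ by
    obtain ⟨δ, hδ, h⟩ := Metric.eventually_nhds_iff.1 h
    refine ⟨δ, hδ, fun x hx hne => ?_⟩
    by_contra! hc
    exact hne (h (by rwa [Real.dist_eq]) hx)
  by_cases hz : ((s + μ⁻¹ : ℝ) : ℂ) ∈ spectrum A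
  · obtain ⟨-, -, ε, hε, h⟩ := hA _ ⟨hneg, hz⟩
    have h1 : ∀ᶠ x in nhds μ, |x⁻¹ - μ⁻¹| < ε := by
      have : Filter.Tendsto (fun x : ℝ => x⁻¹) (nhds μ) (nhds μ⁻¹) := tendsto_inv₀ hμ.ne'
      simpa [Real.dist_eq] using Metric.tendsto_nhds.1 this ε hε
    filter_upwards [h1, Ioi_mem_nhds hμ] with x hx hx0 hxs
    by_contra hne
    have h2 := h _ (mem_spectrum_of_mem_spectrum_resolvent hR (ne_of_gt hx0) hxs) (by
      intro h3
      have h4 : s + x⁻¹ = s + μ⁻¹ := by exact_mod_cast h3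
      exact hne (inv_injective (add_left_cancel h4)))
    rw [← Complex.ofReal_sub, Complex.norm_real, Real.norm_eq_abs, add_sub_add_left_eq_sub] at h2
    linarith
  · have h1 : μ ∉ _root_.spectrum ℝ R := fun h =>
      hz (mem_spectrum_of_mem_spectrum_resolvent hR hμ.ne' h)
    filter_upwards [(spectrum.isClosed (𝕜 := ℝ) R).isOpen_compl.mem_nhds h1] with x hx hxs
    exact absurd hxs hx

/-- A compact set without accumulation points is finite. -/
theorem finite_spectrum_resolvent_above [CompleteSpace E] (hA : HasDiscreteNegSpectrum A) {s : ℝ}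
    {R : E →L[ℂ] E} (hR : IsResolvent A s R) {τ : ℝ} (hτ : 0 < τ) (hneg : s + τ⁻¹ < 0) :
    {x ∈ _root_.spectrum ℝ R | τ ≤ x}.Finite := by
  by_contra hinf
  have hK : IsCompact (_root_.spectrum ℝ R ∩ Set.Ici τ) :=
    (spectrum.isCompact (𝕜 := ℝ) R).inter_right isClosed_Ici
  obtain ⟨μ, hμ, hacc⟩ := Set.Infinite.exists_accPt_of_subset_isCompact hinf hK fun x hx => hx
  have hτμ : τ ≤ μ := hμ.2
  have hμ0 : 0 < μ := hτ.trans_le hτμ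
  obtain ⟨δ, hδ, h⟩ := exists_isolating_radius hA hR hμ0
    ((add_le_add_right (inv_anti₀ hτ hτμ) s).trans_lt hneg)
  rw [accPt_iff_nhds] at hacc
  obtain ⟨y, ⟨hy1, hy2⟩, hy3⟩ := hacc _ (Metric.ball_mem_nhds μ hδ)
  have := h y hy2.1 hy3
  rw [Metric.mem_ball, Real.dist_eq] at hy1
  linarith

theorem finrank_biSup_le {ι : Type*} (T : Finset ι) (S : ι → Submodule ℂ E)
    (hS : ∀ i ∈ T, FiniteDimensional ℂ (S i)) :
    FiniteDimensional ℂ (⨆ i ∈ T, S i : Submodule ℂ E) ∧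
      Module.finrank ℂ (⨆ i ∈ T, S i : Submodule ℂ E) ≤ ∑ i ∈ T, Module.finrank ℂ (S i) := by
  classical
  induction T using Finset.induction_on with
  | empty =>
    have h0 : (⨆ i ∈ (∅ : Finset ι), S i) = ⊥ := by simp
    rw [h0]
    exact ⟨inferInstance, by simp⟩
  | insert a T ha ih =>
    obtain ⟨h1, h2⟩ := ih fun i hi => hS i (Finset.mem_insert_of_mem hi)
    have h3 := hS a (Finset.mem_insert_self _ _)
    rw [Finset.iSup_insert, Finset.sum_insert ha]
    exact ⟨inferInstance, (Submodule.finrank_add_le_finrank_add_finrank _ _).trans (by omega)⟩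

/-- The variational principle (Glazman's lemma): if `A` has discrete negative spectrum and the
form is at most `-κ` on `n` vectors which are orthogonal, also with respect to the form, then there
are at least `n` eigenvalues, counted with multiplicity, below or at `-κ`. -/
theorem IsFormOperator.card_le_sum_finrank [CompleteSpace E] (h : IsFormOperator A j q M)
    (hA : HasDiscreteNegSpectrum A) {κ : ℝ} (hκ : 0 < κ) {ι : Type*} (I : Finset ι) (w : ι → W)
    (horth : ∀ a ∈ I, ∀ b ∈ I, a ≠ b → inner ℂ (j (w a)) (j (w b)) = 0)
    (hqorth : ∀ a ∈ I, ∀ b ∈ I, a ≠ b → q (w a) (w b) = 0)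
    (hne : ∀ a ∈ I, j (w a) ≠ 0) (hle : ∀ a ∈ I, (q (w a) (w a)).re ≤ -κ * ‖j (w a)‖ ^ 2) :
    ∃ T : Finset ℝ, (∀ t ∈ T, t ∈ negSpectrum A ∧ t ≤ -κ) ∧
      I.card ≤ ∑ t ∈ T, Module.finrank ℂ (eigenspace A (t : ℂ)) := by
  classical
  -- Any `s` below both `-M` and `-κ` would do.
  set s : ℝ := -(|M| + κ + 1) with hs
  have hs0 : s < 0 := by have := abs_nonneg M; linarith
  have hsM : s < -M := by have := le_abs_self M; linarith
  obtain ⟨R, hR⟩ : ∃ R, IsResolvent A (s : ℂ) R := h.mem_resolventSet hA hsM hs0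
  have hsκ : 0 < -κ - s := by have := abs_nonneg M; linarith
  set τ : ℝ := (-κ - s)⁻¹ with hτ
  have hτ0 : 0 < τ := inv_pos.2 hsκ
  have hτs : s + τ⁻¹ = -κ := by rw [hτ, inv_inv]; ring
  obtain ⟨δ, hδ, hiso⟩ := exists_isolating_radius hA hR hτ0 (by rw [hτs]; linarith)
  have hfin := finite_spectrum_resolvent_above hA hR hτ0 (by rw [hτs]; linarith)
  -- The gap below `τ` makes the bound on the kernel of the projection strict.
  set σ : ℝ := max (τ - δ) (τ / 2) with hσ
  have hσ0 : 0 < σ := lt_max_of_lt_right (by linarith)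
  have hστ : σ < τ := max_lt (by linarith) (by linarith)
  obtain ⟨P, hP1, hP2⟩ := exists_spectral_cutoff R (h.isSelfAdjoint_resolvent hR) hσ0.le hστ
    (fun x hx hxτ => by
      have := hiso x hx hxτ.ne
      rw [abs_of_neg (by linarith)] at this
      exact le_max_of_le_left (by linarith)) hfin
  have hmem : ∀ μ ∈ hfin.toFinset, μ ∈ _root_.spectrum ℝ R ∧ τ ≤ μ := fun μ hμ =>
    (Set.Finite.mem_toFinset hfin).1 hμ
  have hT : ∀ μ ∈ hfin.toFinset, s + μ⁻¹ ∈ negSpectrum A ∧ s + μ⁻¹ ≤ -κ := by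
    intro μ hμ
    obtain ⟨h1, h2⟩ := hmem μ hμ
    have h3 : s + μ⁻¹ ≤ -κ := by
      rw [← hτs]
      exact add_le_add_right (inv_anti₀ hτ0 h2) s
    exact ⟨⟨by linarith, mem_spectrum_of_mem_spectrum_resolvent hR (hτ0.trans_le h2).ne' h1⟩, h3⟩
  have hker : ∀ μ ∈ hfin.toFinset, LinearMap.ker ((R : E →ₗ[ℂ] E) - (μ : ℂ) • LinearMap.id) ≤
      eigenspace A ((s + μ⁻¹ : ℝ) : ℂ) := by
    intro μ hμ v hv
    refine mem_eigenspace_of_resolvent_eq hR (hτ0.trans_le (hmem μ hμ).2).ne' ?_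
    simpa [sub_eq_zero] using hv
  obtain ⟨hfd, hrank⟩ := finrank_biSup_le hfin.toFinset
    (fun μ => eigenspace A ((s + μ⁻¹ : ℝ) : ℂ)) fun μ hμ => (hA _ (hT μ hμ).1).2.1
  set S : Submodule ℂ E := ⨆ μ ∈ hfin.toFinset, eigenspace A ((s + μ⁻¹ : ℝ) : ℂ) with hS
  have hPS : ∀ u, P u ∈ S := fun u => iSup₂_mono hker (hP1 u)
  let Φ : (I → ℂ) →ₗ[ℂ] W :=
    { toFun := fun c => ∑ a : I, c a • w a
      map_add' := fun c c' => by simp [add_smul, Finset.sum_add_distrib]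
      map_smul' := fun c c' => by simp [Finset.smul_sum, mul_smul] }
  have hqΦ : ∀ c, (q (Φ c) (Φ c)).re = ∑ a : I, ‖c a‖ ^ 2 * (q (w a) (w a)).re := by
    intro c
    have : q (Φ c) (Φ c) = ∑ a : I, ((‖c a‖ ^ 2 : ℝ) : ℂ) * q (w a) (w a) := by
      change q (∑ a : I, c a • w a) (∑ a : I, c a • w a) = _
      rw [LinearMap.map_sum₂]
      refine Finset.sum_congr rfl fun a _ => ?_
      rw [map_sum, Finset.sum_eq_single a]
      · rw [LinearMap.map_smulₛₗ₂, map_smul, smul_eq_mul, smul_eq_mul,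
          ← mul_assoc, Complex.conj_mul']
        push_cast
        rfl
      · intro b _ hb
        rw [LinearMap.map_smulₛₗ₂, map_smul,
          hqorth a a.2 b b.2 fun e => hb (Subtype.ext e.symm), smul_zero, smul_zero]
      · simp
    rw [this, Complex.re_sum]
    simp only [Complex.re_ofReal_mul]
  have hjΦ : ∀ c, ‖j (Φ c)‖ ^ 2 = ∑ a : I, ‖c a‖ ^ 2 * ‖j (w a)‖ ^ 2 := by
    intro c
    have : inner ℂ (j (Φ c)) (j (Φ c)) =
        ∑ a : I, ((‖c a‖ ^ 2 * ‖j (w a)‖ ^ 2 : ℝ) : ℂ) := by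
      change inner ℂ (j (∑ a : I, c a • w a)) (j (∑ a : I, c a • w a)) = _
      simp only [map_sum, map_smul]
      rw [sum_inner]
      refine Finset.sum_congr rfl fun a _ => ?_
      rw [inner_sum, Finset.sum_eq_single a]
      · rw [inner_smul_left, inner_smul_right, ← mul_assoc, Complex.conj_mul',
          inner_self_eq_norm_sq_to_K]
        push_cast
        rfl
      · intro b _ hb
        rw [inner_smul_left, inner_smul_right,
          horth a a.2 b b.2 fun e => hb (Subtype.ext e.symm), mul_zero, mul_zero]
      · simp
    have h2 := congrArg Complex.re this
    rw [inner_self_eq_norm_sq_to_K, ← Complex.ofReal_sum, Complex.ofReal_re] at h2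
    rw [← h2]
    norm_cast
  let L : (I → ℂ) →ₗ[ℂ] S := LinearMap.codRestrict S ((P : E →ₗ[ℂ] E) ∘ₗ j ∘ₗ Φ) fun c => hPS _
  have hinj : Function.Injective L := by
    rw [← LinearMap.ker_eq_bot, LinearMap.ker_eq_bot']
    intro c hc
    have hPc : P (j (Φ c)) = 0 := congrArg Subtype.val hc
    have h1 := h.form_ge hsM.le hR (Φ c) hσ0 (hP2 _ hPc)
    have h2 : (q (Φ c) (Φ c)).re ≤ -κ * ‖j (Φ c)‖ ^ 2 := by
      rw [hqΦ, hjΦ, Finset.mul_sum]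
      refine Finset.sum_le_sum fun a _ => ?_
      calc ‖c a‖ ^ 2 * (q (w a) (w a)).re ≤ ‖c a‖ ^ 2 * (-κ * ‖j (w a)‖ ^ 2) := by
            gcongr
            exact hle a a.2
        _ = _ := by ring
    have h3 : -κ < s + σ⁻¹ := by
      rw [← hτs]
      exact add_lt_add_right (inv_strictAnti₀ hσ0 hστ) s
    have h4 : ‖j (Φ c)‖ ^ 2 = 0 := by
      by_contra hne0
      have : 0 < ‖j (Φ c)‖ ^ 2 := lt_of_le_of_ne (sq_nonneg _) (Ne.symm hne0)
      nlinarith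
    rw [hjΦ, Finset.sum_eq_zero_iff_of_nonneg fun a _ => by positivity] at h4
    funext a
    have h5 := h4 a (Finset.mem_univ _)
    have h6 : ‖j (w a)‖ ≠ 0 := norm_ne_zero_iff.2 (hne a a.2)
    simpa [h6] using h5
  have hcard := LinearMap.finrank_le_finrank_of_injective hinj
  rw [Module.finrank_fintype_fun_eq_card, Fintype.card_coe] at hcard
  refine ⟨hfin.toFinset.image fun μ => s + μ⁻¹, ?_, ?_⟩
  · intro t ht
    obtain ⟨μ, hμ, rfl⟩ := Finset.mem_image.1 ht
    exact hT μ hμ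
  · rw [Finset.sum_image fun x _ y _ hxy => inv_injective (add_left_cancel hxy)]
    exact hcard.trans hrank

/-- Layer cake comparison of two finite weighted families of numbers through their counting
functions. -/
theorem sum_ofReal_le_of_card_le {ι κ : Type*} (I : Finset ι) (T : Finset κ) (a : ι → ℝ)
    (b : κ → ℝ) (m : κ → ℕ)
    (h : ∀ i ∈ I, (I.filter fun k => a i ≤ a k).card ≤ ∑ t ∈ T.filter (fun t => a i ≤ b t), m t) :
    ∑ i ∈ I, ENNReal.ofReal (a i) ≤ ∑ t ∈ T, (m t : ℝ≥0∞) * ENNReal.ofReal (b t) := by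
  classical
  have key : ∀ x : ℝ, ENNReal.ofReal x =
      ∫⁻ y in Set.Ioi (0 : ℝ), (if y < x then 1 else 0 : ℝ≥0∞) := by
    intro x
    have : (fun y : ℝ => (if y < x then 1 else 0 : ℝ≥0∞)) = (Set.Iio x).indicator 1 := by
      funext y
      simp [Set.indicator_apply]
    rw [this, lintegral_indicator_one measurableSet_Iio, Measure.restrict_apply measurableSet_Iio,
      Set.inter_comm, Set.Ioi_inter_Iio, Real.volume_Ioo, sub_zero]
  have hmeas : ∀ x : ℝ, Measurable fun y : ℝ => (if y < x then 1 else 0 : ℝ≥0∞) := fun x =>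
    Measurable.ite measurableSet_Iio measurable_const measurable_const
  simp only [key]
  rw [← lintegral_finsetSum _ fun i _ => hmeas _]
  simp only [← lintegral_const_mul _ (hmeas _)]
  rw [← lintegral_finsetSum _ fun i _ => (hmeas _).const_mul _]
  refine lintegral_mono fun y => ?_
  rw [Finset.sum_ite, Finset.sum_const_zero, add_zero, Finset.sum_const, nsmul_one]
  rcases (I.filter fun i => y < a i).eq_empty_or_nonempty with he | hne
  · simp [he]
  obtain ⟨i, hi, hmin⟩ := Finset.exists_min_image _ a hne
  rw [Finset.mem_filter] at hi
  have h1 : (I.filter fun i => y < a i).card ≤ ∑ t ∈ T.filter (fun t => a i ≤ b t), m t := by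
    refine (Finset.card_le_card fun k hk => ?_).trans (h i hi.1)
    exact Finset.mem_filter.2 ⟨(Finset.mem_filter.1 hk).1, hmin k hk⟩
  have h2 : ∑ t ∈ T.filter (fun t => a i ≤ b t), m t ≤ ∑ t ∈ T.filter (fun t => y < b t), m t :=
    Finset.sum_le_sum_of_subset fun t ht => by
      rw [Finset.mem_filter] at ht ⊢
      exact ⟨ht.1, hi.2.trans_le ht.2⟩
  calc ((I.filter fun i => y < a i).card : ℝ≥0∞)
      ≤ ((∑ t ∈ T.filter (fun t => y < b t), m t : ℕ) : ℝ≥0∞) := by exact_mod_cast h1.trans h2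
    _ = ∑ t ∈ T, (m t : ℝ≥0∞) * (if y < b t then 1 else 0) := by
      push_cast
      rw [Finset.sum_filter]
      refine Finset.sum_congr rfl fun t _ => ?_
      split_ifs <;> simp

/-- The moments of the values of the form on an orthogonal family are dominated by the moments of
the negative eigenvalues. -/
theorem IsFormOperator.sum_rpow_le [CompleteSpace E] (h : IsFormOperator A j q M)
    (hA : HasDiscreteNegSpectrum A) {ι : Type*} (I : Finset ι) (w : ι → W) (κ : ι → ℝ)
    (hκ : ∀ a ∈ I, 0 < κ a)
    (horth : ∀ a ∈ I, ∀ b ∈ I, a ≠ b → inner ℂ (j (w a)) (j (w b)) = 0)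
    (hqorth : ∀ a ∈ I, ∀ b ∈ I, a ≠ b → q (w a) (w b) = 0)
    (hne : ∀ a ∈ I, j (w a) ≠ 0) (hle : ∀ a ∈ I, (q (w a) (w a)).re ≤ -κ a * ‖j (w a)‖ ^ 2)
    {p : ℝ} (hp : 0 < p) :
    ∑ a ∈ I, ENNReal.ofReal (κ a ^ p) ≤ negEigenvalueSum A p := by
  classical
  have h1 : ∀ i ∈ I, ∃ T : Finset ℝ, (∀ t ∈ T, t ∈ negSpectrum A ∧ t ≤ -κ i) ∧
      (I.filter fun k => κ i ≤ κ k).card ≤ ∑ t ∈ T, Module.finrank ℂ (eigenspace A (t : ℂ)) := by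
    intro i hi
    refine h.card_le_sum_finrank hA (hκ i hi) _ w ?_ ?_ ?_ ?_
    · exact fun a ha b hb => horth a (Finset.mem_filter.1 ha).1 b (Finset.mem_filter.1 hb).1
    · exact fun a ha b hb => hqorth a (Finset.mem_filter.1 ha).1 b (Finset.mem_filter.1 hb).1
    · exact fun a ha => hne a (Finset.mem_filter.1 ha).1
    · intro a ha
      rw [Finset.mem_filter] at ha
      refine (hle a ha.1).trans ?_
      have := ha.2
      gcongr
  choose! T hT hcard using h1
  have hU : ∀ t ∈ I.biUnion T, t ∈ negSpectrum A := by
    intro t ht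
    obtain ⟨i, hi, hit⟩ := Finset.mem_biUnion.1 ht
    exact (hT i hi t hit).1
  calc ∑ a ∈ I, ENNReal.ofReal (κ a ^ p)
      ≤ ∑ t ∈ I.biUnion T,
          (Module.finrank ℂ (eigenspace A (t : ℂ)) : ℝ≥0∞) * ENNReal.ofReal (|t| ^ p) := by
        refine sum_ofReal_le_of_card_le I _ (fun i => κ i ^ p) (fun t => |t| ^ p)
          (fun t => Module.finrank ℂ (eigenspace A (t : ℂ))) fun i hi => ?_
        have h2 : (I.filter fun k => κ i ^ p ≤ κ k ^ p) = I.filter fun k => κ i ≤ κ k :=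
          Finset.filter_congr fun k hk =>
            Real.rpow_le_rpow_iff (hκ i hi).le (hκ k hk).le hp
        simp only [h2]
        refine (hcard i hi).trans (Finset.sum_le_sum_of_subset fun t ht => ?_)
        refine Finset.mem_filter.2 ⟨Finset.mem_biUnion.2 ⟨i, hi, ht⟩, ?_⟩
        have h3 := (hT i hi t ht).2
        have h4 := hκ i hi
        exact Real.rpow_le_rpow h4.le (by rw [abs_of_neg (by linarith)]; linarith) hp.le
    _ = ∑ t ∈ (I.biUnion T).subtype (fun t => t ∈ negSpectrum A),
          (Module.finrank ℂ (eigenspace A ((t : ℝ) : ℂ)) : ℝ≥0∞) *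
            ENNReal.ofReal (|(t : ℝ)| ^ p) := by
        rw [Finset.sum_subtype_of_mem (fun t : ℝ =>
          (Module.finrank ℂ (eigenspace A (t : ℂ)) : ℝ≥0∞) * ENNReal.ofReal (|t| ^ p)) hU]
    _ ≤ negEigenvalueSum A p := ENNReal.sum_le_tsum _

/-- The Rayleigh bound for the lowest eigenvalue. -/
theorem IsFormOperator.lowestEigenvalue_le [CompleteSpace E] (h : IsFormOperator A j q M)
    (hA : HasDiscreteNegSpectrum A) {κ : ℝ} (hκ : 0 < κ) {w : W} (hw : j w ≠ 0)
    (hle : (q w w).re ≤ -κ * ‖j w‖ ^ 2) : lowestEigenvalue A ≤ -κ := by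
  obtain ⟨T, hT, hcard⟩ := h.card_le_sum_finrank hA hκ (Finset.univ : Finset Unit) (fun _ => w)
    (fun a _ b _ hab => absurd rfl hab) (fun a _ b _ hab => absurd rfl hab) (fun _ _ => hw)
    fun _ _ => hle
  have hne : T.Nonempty := by
    rw [Finset.nonempty_iff_ne_empty]
    rintro rfl
    simp at hcard
  obtain ⟨t, ht⟩ := hne
  refine (csInf_le ⟨-|M|, ?_⟩ (Set.mem_insert_of_mem _ (hT t ht).1)).trans (hT t ht).2
  rintro x (rfl | hx)
  · simp
  · by_contra! hc
    have := le_abs_self M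
    exact hx.2 (h.mem_resolventSet hA (by linarith) hx.1)

end Form

/-! ### The form of the Schrödinger operator -/

section SchrodingerForm

variable {d : ℕ} {V : EuclideanSpace ℝ (Fin d) → ℝ}

/-- The form domain `W^{1,2}({|x| > 1})`, as the space of pairs of a function and its weak
gradient. -/
noncomputable def formDomain (d : ℕ) : Submodule ℂ (L2 d × (Fin d → L2 d)) where
  carrier := {w | HasWeakGradient w.1 w.2}
  zero_mem' := HasWeakGradient.zero
  add_mem' := fun ha hb => ha.add hb
  smul_mem' := fun c _ ha => ha.smul c

/-- The inclusion of the form domain in `L²`. -/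
noncomputable def formInclusion (d : ℕ) : formDomain d →ₗ[ℂ] L2 d :=
  LinearMap.fst ℂ _ _ ∘ₗ (formDomain d).subtype

theorem IsAdmissible.mem_domain_mulOp (hV : IsAdmissible d V) (u : L2 d) :
    u ∈ (mulOp d V).domain := by
  obtain ⟨M, hM⟩ := hV.bounded
  refine (Lp.memLp u).of_le_mul (c := M)
    (hV.aemeasurable.aestronglyMeasurable.smul (Lp.aestronglyMeasurable u)) ?_
  filter_upwards [hV.pos, hM] with x h0 h1
  rw [norm_smul, Real.norm_of_nonneg h0.le]
  gcongr

/-- Multiplication by an admissible potential, as an everywhere defined linear map. -/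
noncomputable def potential (hV : IsAdmissible d V) : L2 d →ₗ[ℂ] L2 d :=
  (mulOp d V).toFun ∘ₗ LinearMap.codRestrict _ LinearMap.id hV.mem_domain_mulOp

theorem coeFn_potential (hV : IsAdmissible d V) (u : L2 d) :
    potential hV u =ᵐ[extMeasure d] fun x => V x • u x :=
  MemLp.coeFn_toLp (hV.mem_domain_mulOp u)

theorem norm_potential_le (hV : IsAdmissible d V) {M : ℝ}
    (hM : ∀ᵐ x ∂(extMeasure d), V x ≤ M) (u : L2 d) : ‖potential hV u‖ ≤ M * ‖u‖ := by
  refine Lp.norm_le_mul_norm_of_ae_le_mul ?_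
  filter_upwards [hV.pos, hM, coeFn_potential hV u] with x h0 h1 h2
  rw [h2, norm_smul, Real.norm_of_nonneg h0.le]
  gcongr

theorem inner_potential_comm (hV : IsAdmissible d V) (u v : L2 d) :
    inner ℂ (potential hV u) v = inner ℂ u (potential hV v) := by
  rw [L2.inner_def, L2.inner_def]
  refine integral_congr_ae ?_
  filter_upwards [coeFn_potential hV u, coeFn_potential hV v] with x h1 h2
  rw [h1, h2, ← Complex.coe_smul, ← Complex.coe_smul, inner_smul_left, inner_smul_right,
    Complex.conj_ofReal]

/-- The quadratic form `∫ (conj ∇u · ∇v - V conj u v)`. -/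
noncomputable def schrodingerForm (hV : IsAdmissible d V) :
    formDomain d →ₗ⋆[ℂ] formDomain d →ₗ[ℂ] ℂ :=
  LinearMap.mk₂'ₛₗ (starRingEnd ℂ) (RingHom.id ℂ)
    (fun v w => ∑ i, inner ℂ (v.1.2 i) (w.1.2 i) - inner ℂ v.1.1 (potential hV w.1.1))
    (fun a b c => by
      simp only [Submodule.coe_add, Prod.snd_add, Prod.fst_add, Pi.add_apply, inner_add_left,
        Finset.sum_add_distrib]
      ring)
    (fun c a b => by
      simp only [Submodule.coe_smul, Prod.smul_snd, Prod.smul_fst, Pi.smul_apply, inner_smul_left,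
        ← Finset.mul_sum, smul_eq_mul]
      ring)
    (fun a b c => by
      simp only [Submodule.coe_add, Prod.snd_add, Prod.fst_add, Pi.add_apply, inner_add_right,
        Finset.sum_add_distrib, map_add]
      ring)
    (fun c a b => by
      simp only [Submodule.coe_smul, Prod.smul_snd, Prod.smul_fst, Pi.smul_apply, inner_smul_right,
        ← Finset.mul_sum, smul_eq_mul, map_smul, RingHom.id_apply]
      ring)

theorem schrodingerForm_apply (hV : IsAdmissible d V) (v w : formDomain d) :
    schrodingerForm hV v w =
      ∑ i, inner ℂ (v.1.2 i) (w.1.2 i) - inner ℂ v.1.1 (potential hV w.1.1) := rfl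

theorem exists_isFormOperator_schrodinger (hV : IsAdmissible d V) :
    ∃ M, IsFormOperator (schrodinger d V) (formInclusion d) (schrodingerForm hV) M := by
  obtain ⟨M, hM⟩ := hV.bounded
  refine ⟨M, fun v w => ?_, fun w => ?_, fun u => ?_⟩
  · rw [schrodingerForm_apply, schrodingerForm_apply, star_sub, star_sum]
    congr 1
    · exact Finset.sum_congr rfl fun i _ => inner_conj_symm _ _
    · rw [← inner_potential_comm]
      exact inner_conj_symm _ _
  · have h1 : (inner ℂ w.1.1 (potential hV w.1.1)).re ≤ M * ‖w.1.1‖ ^ 2 := by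
      calc (inner ℂ w.1.1 (potential hV w.1.1)).re ≤ ‖w.1.1‖ * ‖potential hV w.1.1‖ :=
            re_inner_le_norm (𝕜 := ℂ) _ _
        _ ≤ ‖w.1.1‖ * (M * ‖w.1.1‖) := by gcongr; exact norm_potential_le hV hM _
        _ = _ := by ring
    have h2 : 0 ≤ (∑ i, inner ℂ (w.1.2 i) (w.1.2 i)).re := by
      rw [Complex.re_sum]
      exact Finset.sum_nonneg fun i _ => inner_self_nonneg (𝕜 := ℂ)
    rw [schrodingerForm_apply, Complex.sub_re]
    change -M * ‖w.1.1‖ ^ 2 ≤ _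
    linarith
  · have hu : ((u : L2 d), neumannLaplacian d ⟨u, u.2.1⟩) ∈ neumannLaplacianGraph d := by
      rw [← neumannLaplacian_graph]
      exact (neumannLaplacian d).mem_graph ⟨(u : L2 d), u.2.1⟩
    obtain ⟨G, hG, hG'⟩ := hu
    refine ⟨⟨((u : L2 d), G), hG⟩, rfl, fun v => ?_⟩
    have h1 : schrodinger d V u = neumannLaplacian d ⟨u, u.2.1⟩ - potential hV u := rfl
    rw [schrodingerForm_apply, h1, inner_sub_right, hG' v.1.1 v.1.2 v.2]
    rfl

end SchrodingerForm

/-! ### Lipschitz test functions -/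

section Lipschitz

variable {d : ℕ} {V : EuclideanSpace ℝ (Fin d) → ℝ}

theorem memLp_lineDeriv {ψ : EuclideanSpace ℝ (Fin d) → ℝ} {C : ℝ≥0} (hψ : LipschitzWith C ψ)
    (hs : HasCompactSupport ψ) (v : EuclideanSpace ℝ (Fin d)) :
    MemLp (fun x => ((lineDeriv ℝ ψ x v : ℝ) : ℂ)) 2 (extMeasure d) := by
  have hmeas : Measurable fun x => ((lineDeriv ℝ ψ x v : ℝ) : ℂ) :=
    Complex.measurable_ofReal.comp (measurable_lineDeriv hψ.continuous)
  have h : MemLp ((tsupport ψ).indicator fun _ => ((C * ‖v‖ : ℝ) : ℂ)) 2 (extMeasure d) :=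
    memLp_indicator_const 2 (isClosed_tsupport ψ).measurableSet _
      (Or.inr (hs.isCompact.measure_lt_top.ne))
  refine h.mono hmeas.aestronglyMeasurable (Filter.Eventually.of_forall fun x => ?_)
  by_cases hx : x ∈ tsupport ψ
  · rw [Set.indicator_of_mem hx, Complex.norm_real, Complex.norm_real,
      Real.norm_of_nonneg (by positivity : (0 : ℝ) ≤ C * ‖v‖)]
    exact norm_lineDeriv_le_of_lipschitz ℝ hψ
  · have h0 : ψ =ᶠ[nhds x] fun _ => 0 := notMem_tsupport_iff_eventuallyEq.1 hx
    rw [Filter.EventuallyEq.lineDeriv_eq h0]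
    simp [lineDeriv]

/-- Lipschitz functions with compact support have a weak gradient, whose components are the
directional derivatives. -/
theorem hasWeakGradient_of_lipschitz {ψ : EuclideanSpace ℝ (Fin d) → ℝ} {C : ℝ≥0}
    (hψ : LipschitzWith C ψ) (hs : HasCompactSupport ψ) :
    HasWeakGradient (memLp_test hψ.continuous hs).toLp
      (fun i => (memLp_lineDeriv hψ hs (EuclideanSpace.single i 1)).toLp) := by
  intro i η hη
  obtain ⟨D, hD⟩ := ContDiff.lipschitzWith_of_hasCompactSupport (𝕂 := ℝ) hη.hasCompactSupport
    hη.contDiff (by simp)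
  have h1 := LipschitzWith.integral_lineDeriv_mul_eq (μ := volume) hψ hD hη.hasCompactSupport
    (EuclideanSpace.single i (1 : ℝ))
  have h0 : ∀ x, lineDeriv ℝ η x (-EuclideanSpace.single i (1 : ℝ)) = -partialDeriv i η x := by
    intro x
    rw [lineDeriv_neg, DifferentiableAt.lineDeriv_eq_fderiv
      (hη.contDiff.differentiable (by simp) x)]
    rfl
  simp only [h0, neg_mul] at h1
  rw [integral_neg] at h1
  have hη0 : ∀ x ∉ exterior d, x ∉ tsupport η := fun x hx h' => hx (hη.tsupport_subset h')
  have h2 : ∫ x, partialDeriv i η x * ψ x ∂(extMeasure d) = ∫ x, partialDeriv i η x * ψ x :=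
    setIntegral_eq_integral_of_forall_compl_eq_zero fun x hx => by
      rw [partialDeriv, fderiv_of_notMem_tsupport ℝ (hη0 x hx)]
      simp
  have h3 : ∫ x, lineDeriv ℝ ψ x (EuclideanSpace.single i 1) * η x ∂(extMeasure d) =
      ∫ x, lineDeriv ℝ ψ x (EuclideanSpace.single i 1) * η x :=
    setIntegral_eq_integral_of_forall_compl_eq_zero fun x hx => by
      rw [image_eq_zero_of_notMem_tsupport (hη0 x hx), mul_zero]
  rw [← h2, ← h3] at h1
  have h4 := congrArg Complex.ofReal h1
  rw [Complex.ofReal_neg, ← integral_complex_ofReal, ← integral_complex_ofReal] at h4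
  have h5 : ∫ x, partialDeriv i η x • (memLp_test hψ.continuous hs).toLp _ x ∂(extMeasure d) =
      ∫ x, ((partialDeriv i η x * ψ x : ℝ) : ℂ) ∂(extMeasure d) := by
    refine integral_congr_ae ?_
    filter_upwards [(memLp_test hψ.continuous hs).coeFn_toLp] with x hx
    rw [hx]
    simp
  have h6 : ∫ x, η x • (memLp_lineDeriv hψ hs (EuclideanSpace.single i 1)).toLp _ x
      ∂(extMeasure d) = ∫ x, ((lineDeriv ℝ ψ x (EuclideanSpace.single i 1) * η x : ℝ) : ℂ)
        ∂(extMeasure d) := by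
    refine integral_congr_ae ?_
    filter_upwards [(memLp_lineDeriv hψ hs (EuclideanSpace.single i 1)).coeFn_toLp] with x hx
    rw [hx]
    simp [mul_comm]
  rw [h5, h6, h4, neg_neg]

/-- A Lipschitz function with compact support as an element of the form domain. -/
noncomputable def lipschitzElement {ψ : EuclideanSpace ℝ (Fin d) → ℝ} {C : ℝ≥0}
    (hψ : LipschitzWith C ψ) (hs : HasCompactSupport ψ) : formDomain d :=
  ⟨((memLp_test hψ.continuous hs).toLp,
    fun i => (memLp_lineDeriv hψ hs (EuclideanSpace.single i 1)).toLp),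
    hasWeakGradient_of_lipschitz hψ hs⟩

/-- Where a nonnegative function vanishes it has a minimum, so all directional derivatives vanish,
also with the junk value of a derivative which does not exist. -/
theorem lineDeriv_eq_zero_of_nonneg {ψ : EuclideanSpace ℝ (Fin d) → ℝ} (h0 : ∀ x, 0 ≤ ψ x)
    {x : EuclideanSpace ℝ (Fin d)} (hx : ψ x = 0) (v : EuclideanSpace ℝ (Fin d)) :
    lineDeriv ℝ ψ x v = 0 := by
  refine IsLocalMin.deriv_eq_zero (f := fun t : ℝ => ψ (x + t • v)) ?_
  refine Filter.Eventually.of_forall fun t => ?_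
  simpa [hx] using h0 _

theorem inner_toLp_eq_zero {f g : EuclideanSpace ℝ (Fin d) → ℂ} (hf : MemLp f 2 (extMeasure d))
    (hg : MemLp g 2 (extMeasure d)) (h : ∀ x, f x = 0 ∨ g x = 0) :
    inner ℂ hf.toLp hg.toLp = 0 := by
  rw [L2.inner_def]
  refine integral_eq_zero_of_ae ?_
  filter_upwards [hf.coeFn_toLp, hg.coeFn_toLp] with x h1 h2
  rw [h1, h2]
  rcases h x with h | h <;> simp [h]

section Disjoint

variable {ψ φ : EuclideanSpace ℝ (Fin d) → ℝ} {C D : ℝ≥0}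
  (hψ : LipschitzWith C ψ) (hψs : HasCompactSupport ψ) (hφ : LipschitzWith D φ)
  (hφs : HasCompactSupport φ)

theorem inner_lipschitzElement_eq_zero (h : ∀ x, ψ x = 0 ∨ φ x = 0) :
    inner ℂ (formInclusion d (lipschitzElement hψ hψs))
      (formInclusion d (lipschitzElement hφ hφs)) = 0 :=
  inner_toLp_eq_zero (memLp_test hψ.continuous hψs) (memLp_test hφ.continuous hφs)
    fun x => by simpa using h x

theorem schrodingerForm_lipschitzElement_eq_zero (hV : IsAdmissible d V) (hψ0 : ∀ x, 0 ≤ ψ x)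
    (hφ0 : ∀ x, 0 ≤ φ x) (h : ∀ x, ψ x = 0 ∨ φ x = 0) :
    schrodingerForm hV (lipschitzElement hψ hψs) (lipschitzElement hφ hφs) = 0 := by
  rw [schrodingerForm_apply, Finset.sum_eq_zero, zero_sub, neg_eq_zero]
  · rw [L2.inner_def]
    refine integral_eq_zero_of_ae ?_
    filter_upwards [coeFn_potential hV (lipschitzElement hφ hφs).1.1,
      (memLp_test hψ.continuous hψs).coeFn_toLp, (memLp_test hφ.continuous hφs).coeFn_toLp]
      with x h1 h2 h3
    rw [h1]
    change inner ℂ ((memLp_test hψ.continuous hψs).toLp _ x)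
      (V x • (memLp_test hφ.continuous hφs).toLp _ x) = 0
    rw [h2, h3]
    rcases h x with h | h <;> simp [h]
  · intro i _
    refine inner_toLp_eq_zero (memLp_lineDeriv hψ hψs (EuclideanSpace.single i 1))
      (memLp_lineDeriv hφ hφs (EuclideanSpace.single i 1)) fun x => ?_
    rcases h x with h | h
    · exact Or.inl (by rw [lineDeriv_eq_zero_of_nonneg hψ0 h, Complex.ofReal_zero])
    · exact Or.inr (by rw [lineDeriv_eq_zero_of_nonneg hφ0 h, Complex.ofReal_zero])

end Disjoint

theorem norm_sq_toLp_le {f : EuclideanSpace ℝ (Fin d) → ℂ} (hf : MemLp f 2 (extMeasure d))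
    {B : Set (EuclideanSpace ℝ (Fin d))} (hB : MeasurableSet B) (hBfin : extMeasure d B ≠ ⊤)
    {c : ℝ} (hc : 0 ≤ c) (h : ∀ x ∈ exterior d, ‖f x‖ ≤ B.indicator (fun _ => c) x) :
    ‖hf.toLp‖ ^ 2 ≤ c ^ 2 * (extMeasure d).real B := by
  have h1 : ‖hf.toLp‖ ≤ ‖indicatorConstLp 2 hB hBfin c‖ := by
    refine Lp.norm_le_norm_of_ae_le ?_
    filter_upwards [hf.coeFn_toLp, indicatorConstLp_coeFn (p := 2) (hs := hB) (hμs := hBfin)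
      (c := c), ae_restrict_mem isOpen_exterior.measurableSet] with x h1 h2 h3
    rw [h1, h2]
    refine (h x h3).trans (le_abs_self _)
  rw [norm_indicatorConstLp (by norm_num) (by norm_num), Real.norm_of_nonneg hc] at h1
  calc ‖hf.toLp‖ ^ 2 ≤ (c * (extMeasure d).real B ^ (1 / (2 : ℝ≥0∞).toReal)) ^ 2 := by gcongr
    _ = c ^ 2 * (extMeasure d).real B := by
      rw [mul_pow, ← Real.rpow_natCast (_ ^ _), ← Real.rpow_mul measureReal_nonneg]
      simp

/-- Bounds for the norm and the form of a cutoff function which is `1` on `A` and vanishes outside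
of `B`. -/
theorem cutoff_bounds (hV : IsAdmissible d V) {ψ : EuclideanSpace ℝ (Fin d) → ℝ} {C : ℝ≥0}
    (hψ : LipschitzWith C ψ) (hs : HasCompactSupport ψ) (h0 : ∀ x, 0 ≤ ψ x) (h1 : ∀ x, ψ x ≤ 1)
    {A B : Set (EuclideanSpace ℝ (Fin d))} (hA : MeasurableSet A) (hB : MeasurableSet B)
    (hBfin : extMeasure d B ≠ ⊤) (hψA : ∀ x ∈ A, ψ x = 1)
    (hψB : ∀ x ∈ exterior d, x ∉ B → ψ x = 0) :
    ‖formInclusion d (lipschitzElement hψ hs)‖ ^ 2 ≤ (extMeasure d).real B ∧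
    (schrodingerForm hV (lipschitzElement hψ hs) (lipschitzElement hψ hs)).re ≤
      d * C ^ 2 * (extMeasure d).real B - ∫ x in A, V x ∂(extMeasure d) := by
  constructor
  · refine (norm_sq_toLp_le (memLp_test hψ.continuous hs) hB hBfin zero_le_one fun x hx => ?_).trans
      (by simp)
    by_cases hxB : x ∈ B
    · rw [Set.indicator_of_mem hxB, Complex.norm_real, Real.norm_of_nonneg (h0 x)]
      exact h1 x
    · rw [hψB x hx hxB]
      simp [hxB]
  · rw [schrodingerForm_apply, Complex.sub_re, Complex.re_sum]
    have hgrad : ∑ i, (inner ℂ ((lipschitzElement hψ hs).1.2 i)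
        ((lipschitzElement hψ hs).1.2 i)).re ≤ d * C ^ 2 * (extMeasure d).real B := by
      calc ∑ i, (inner ℂ ((lipschitzElement hψ hs).1.2 i) ((lipschitzElement hψ hs).1.2 i)).re
          ≤ ∑ _i : Fin d, (C : ℝ) ^ 2 * (extMeasure d).real B := by
            refine Finset.sum_le_sum fun i _ => ?_
            have h2 : (inner ℂ ((lipschitzElement hψ hs).1.2 i)
                ((lipschitzElement hψ hs).1.2 i)).re = ‖(lipschitzElement hψ hs).1.2 i‖ ^ 2 :=
              inner_self_eq_norm_sq (𝕜 := ℂ) _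
            rw [h2]
            refine norm_sq_toLp_le (memLp_lineDeriv hψ hs _) hB hBfin C.2 fun x hx => ?_
            rw [Complex.norm_real]
            by_cases hxB : x ∈ B
            · rw [Set.indicator_of_mem hxB]
              refine (norm_lineDeriv_le_of_lipschitz ℝ hψ).trans ?_
              simp
            · rw [lineDeriv_eq_zero_of_nonneg h0 (hψB x hx hxB)]
              simp [hxB]
        _ = d * C ^ 2 * (extMeasure d).real B := by simp [mul_assoc]
    have hpot : ∫ x in A, V x ∂(extMeasure d) ≤ (inner ℂ (lipschitzElement hψ hs).1.1
        (potential hV (lipschitzElement hψ hs).1.1)).re := by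
      set u : L2 d := (lipschitzElement hψ hs).1.1 with hu
      have hae : (fun x => inner ℂ (u x) (potential hV u x)) =ᵐ[extMeasure d]
          fun x => ((V x * ψ x ^ 2 : ℝ) : ℂ) := by
        have h2 : u =ᵐ[extMeasure d] fun x => (ψ x : ℂ) :=
          (memLp_test hψ.continuous hs).coeFn_toLp
        filter_upwards [coeFn_potential hV u, h2] with x h3 h4
        rw [h3, h4, Complex.real_smul, RCLike.inner_apply, Complex.conj_ofReal]
        push_cast
        ring
      have hint : Integrable (fun x => V x * ψ x ^ 2) (extMeasure d) := by
        have h3 := (L2.integrable_inner (𝕜 := ℂ) u (potential hV u)).congr hae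
        exact h3.re
      rw [L2.inner_def, integral_congr_ae hae, integral_complex_ofReal, Complex.ofReal_re]
      calc ∫ x in A, V x ∂(extMeasure d) = ∫ x in A, V x * ψ x ^ 2 ∂(extMeasure d) :=
            setIntegral_congr_fun hA fun x hx => by simp [hψA x hx]
        _ ≤ ∫ x, V x * ψ x ^ 2 ∂(extMeasure d) := by
            refine setIntegral_le_integral hint ?_
            filter_upwards [hV.pos] with x hx
            exact mul_nonneg hx.le (sq_nonneg _)
    linarith

end Lipschitz

/-! ### Annuli and the mass of a potential -/

section Annulus

variable {d : ℕ} {V : EuclideanSpace ℝ (Fin d) → ℝ}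

/-- The annulus `{a < |x| ≤ b}`. -/
def annulus (d : ℕ) (a b : ℝ) : Set (EuclideanSpace ℝ (Fin d)) := {x | a < ‖x‖ ∧ ‖x‖ ≤ b}

theorem measurableSet_annulus (a b : ℝ) : MeasurableSet (annulus d a b) :=
  (measurableSet_lt measurable_const measurable_norm).inter
    (measurableSet_le measurable_norm measurable_const)

theorem annulus_subset_exterior {a b : ℝ} (ha : 1 ≤ a) : annulus d a b ⊆ exterior d :=
  fun _ hx => ha.trans_lt hx.1

theorem annulus_union {a b c : ℝ} (hab : a ≤ b) (hbc : b ≤ c) :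
    annulus d a b ∪ annulus d b c = annulus d a c := by
  ext x
  simp only [annulus, Set.mem_union, Set.mem_ofPred_eq]
  constructor
  · rintro (⟨h1, h2⟩ | ⟨h1, h2⟩)
    · exact ⟨h1, h2.trans hbc⟩
    · exact ⟨hab.trans_lt h1, h2⟩
  · rintro ⟨h1, h2⟩
    rcases le_or_gt ‖x‖ b with h | h
    · exact Or.inl ⟨h1, h⟩
    · exact Or.inr ⟨h, h2⟩

theorem disjoint_annulus {a b c e : ℝ} (hbc : b ≤ c) :
    Disjoint (annulus d a b) (annulus d c e) := by
  rw [Set.disjoint_left]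
  rintro x ⟨-, h⟩ ⟨h', -⟩
  linarith

theorem volume_annulus_lt_top (a b : ℝ) : volume (annulus d a b) < ⊤ :=
  (measure_mono fun x hx => by simpa using hx.2).trans_lt
    (measure_closedBall_lt_top (x := (0 : EuclideanSpace ℝ (Fin d))) (r := b))

theorem extMeasure_annulus {a b : ℝ} (ha : 1 ≤ a) :
    (extMeasure d).restrict (annulus d a b) = volume.restrict (annulus d a b) :=
  Measure.restrict_restrict_of_subset (annulus_subset_exterior ha)

theorem extMeasure_real_annulus {a b : ℝ} (ha : 1 ≤ a) :
    (extMeasure d).real (annulus d a b) = volume.real (annulus d a b) := by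
  rw [measureReal_def, measureReal_def,
    Measure.restrict_eq_self _ (annulus_subset_exterior ha)]

theorem pow_succ_sub_pow_succ_le {a b : ℝ} (ha : 0 ≤ a) (hab : a ≤ b) (n : ℕ) :
    b ^ (n + 1) - a ^ (n + 1) ≤ (n + 1) * b ^ n * (b - a) := by
  induction n with
  | zero => simp
  | succ n ih =>
    have h1 : a ^ (n + 1) ≤ b ^ (n + 1) := by gcongr
    have h2 : b * (b ^ (n + 1) - a ^ (n + 1)) ≤ b * ((n + 1) * b ^ n * (b - a)) := by
      have : 0 ≤ b := ha.trans hab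
      gcongr
    have h3 : a ^ (n + 1) * (b - a) ≤ b ^ (n + 1) * (b - a) := by
      have : 0 ≤ b - a := sub_nonneg.2 hab
      gcongr
    push_cast
    calc b ^ (n + 1 + 1) - a ^ (n + 1 + 1)
        = b * (b ^ (n + 1) - a ^ (n + 1)) + a ^ (n + 1) * (b - a) := by ring
      _ ≤ b * ((n + 1) * b ^ n * (b - a)) + b ^ (n + 1) * (b - a) := add_le_add h2 h3
      _ = _ := by ring

/-- The constant `D` for which `D r^{d-1} l` bounds the volume of an annulus of thickness at most
`3 l` inside of the ball of radius `3 r`. -/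
noncomputable def annulusConst (d : ℕ) : ℝ :=
  volume.real (Metric.ball (0 : EuclideanSpace ℝ (Fin d)) 1) * d * 3 ^ d

theorem annulusConst_pos (hd : 1 ≤ d) : 0 < annulusConst d := by
  have h1 : 0 < volume.real (Metric.ball (0 : EuclideanSpace ℝ (Fin d)) 1) :=
    ENNReal.toReal_pos (Metric.measure_ball_pos _ _ one_pos).ne' measure_ball_lt_top.ne
  have h2 : (0 : ℝ) < d := by exact_mod_cast hd
  unfold annulusConst
  positivity

theorem volume_annulus_le (hd : 1 ≤ d) {a b : ℝ} (ha : 0 ≤ a) (hab : a ≤ b) :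
    volume.real (annulus d a b) ≤
      volume.real (Metric.ball (0 : EuclideanSpace ℝ (Fin d)) 1) * d * b ^ (d - 1) * (b - a) := by
  set β := volume.real (Metric.ball (0 : EuclideanSpace ℝ (Fin d)) 1) with hβ
  have hball : ∀ r : ℝ, 0 ≤ r →
      volume.real (Metric.closedBall (0 : EuclideanSpace ℝ (Fin d)) r) = r ^ d * β := by
    intro r hr
    rw [Measure.addHaar_real_closedBall _ _ hr, finrank_euclideanSpace_fin]
  have h1 : annulus d a b = Metric.closedBall 0 b \ Metric.closedBall 0 a := by
    ext x
    simp [annulus, and_comm]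
  rw [h1, measureReal_sdiff (Metric.closedBall_subset_closedBall hab)
    measurableSet_closedBall measure_closedBall_lt_top.ne, hball b (ha.trans hab), hball a ha]
  -- For `d = n + 1` the exponent `d - 1` becomes `n`.
  obtain ⟨n, rfl⟩ : ∃ n, d = n + 1 := ⟨d - 1, by omega⟩
  have h2 := pow_succ_sub_pow_succ_le ha hab n
  have h3 : 0 ≤ β := measureReal_nonneg
  calc b ^ (n + 1) * β - a ^ (n + 1) * β = β * (b ^ (n + 1) - a ^ (n + 1)) := by ring
    _ ≤ β * ((n + 1) * b ^ n * (b - a)) := by gcongr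
    _ = _ := by rw [Nat.add_sub_cancel]; push_cast; ring

/-- The mass `∫_{a<|x|≤b} V |x|^{1-d} dx`. -/
noncomputable def mass (V : EuclideanSpace ℝ (Fin d) → ℝ) (a b : ℝ) : ℝ :=
  ∫ x in annulus d a b, V x * ‖x‖ ^ (1 - (d : ℝ)) ∂(extMeasure d)

theorem rpow_one_sub_le (hd : 1 ≤ d) {a r : ℝ} (ha : 0 < a) (har : a ≤ r) :
    r ^ (1 - (d : ℝ)) ≤ (a ^ (d - 1))⁻¹ := by
  have h1 : (a ^ (d - 1))⁻¹ = a ^ (1 - (d : ℝ)) := by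
    rw [← Real.rpow_natCast, ← Real.rpow_neg ha.le, Nat.cast_sub hd]
    congr 1
    push_cast
    ring
  rw [h1]
  refine Real.rpow_le_rpow_of_nonpos ha har ?_
  have : (1 : ℝ) ≤ d := by exact_mod_cast hd
  linarith

theorem aemeasurable_density (hV : IsAdmissible d V) :
    AEMeasurable (fun x => V x * ‖x‖ ^ (1 - (d : ℝ))) (extMeasure d) :=
  hV.aemeasurable.mul (measurable_norm.pow_const _).aemeasurable

theorem density_pos (hV : IsAdmissible d V) :
    ∀ᵐ x ∂(extMeasure d), 0 < V x * ‖x‖ ^ (1 - (d : ℝ)) := by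
  filter_upwards [hV.pos, ae_restrict_mem isOpen_exterior.measurableSet] with x h0 h2
  exact mul_pos h0 (Real.rpow_pos_of_pos (zero_lt_one.trans h2) _)

theorem density_le (hd : 1 ≤ d) (hV : IsAdmissible d V) :
    ∃ M, 0 ≤ M ∧ ∀ᵐ x ∂(extMeasure d), V x ≤ M ∧ V x * ‖x‖ ^ (1 - (d : ℝ)) ≤ M := by
  obtain ⟨M, hM⟩ := hV.bounded
  refine ⟨max M 0, le_max_right _ _, ?_⟩
  filter_upwards [hV.pos, hM, ae_restrict_mem isOpen_exterior.measurableSet] with x h0 h1 h2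
  have h3 : ‖x‖ ^ (1 - (d : ℝ)) ≤ 1 := by simpa using rpow_one_sub_le hd one_pos (le_of_lt h2)
  refine ⟨h1.trans (le_max_left _ _), ?_⟩
  calc V x * ‖x‖ ^ (1 - (d : ℝ)) ≤ V x * 1 := by gcongr
    _ ≤ max M 0 := by rw [mul_one]; exact h1.trans (le_max_left _ _)

theorem integrableOn_of_nonneg_of_le {f : EuclideanSpace ℝ (Fin d) → ℝ}
    (hf : AEMeasurable f (extMeasure d)) {M : ℝ}
    (h0 : ∀ᵐ x ∂(extMeasure d), 0 ≤ f x ∧ f x ≤ M) (a b : ℝ) :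
    IntegrableOn f (annulus d a b) (extMeasure d) := by
  refine Measure.integrableOn_of_bounded (M := M) ?_ hf.aestronglyMeasurable ?_
  · exact ((Measure.restrict_apply_le _ _).trans_lt (volume_annulus_lt_top a b)).ne
  · filter_upwards [ae_restrict_of_ae h0] with x hx
    rw [Real.norm_of_nonneg hx.1]
    exact hx.2

theorem integrableOn_density (hd : 1 ≤ d) (hV : IsAdmissible d V) (a b : ℝ) :
    IntegrableOn (fun x => V x * ‖x‖ ^ (1 - (d : ℝ))) (annulus d a b) (extMeasure d) := by
  obtain ⟨M, -, hM⟩ := density_le hd hV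
  refine integrableOn_of_nonneg_of_le (aemeasurable_density hV) (M := M) ?_ a b
  filter_upwards [hM, density_pos hV] with x h1 h2
  exact ⟨h2.le, h1.2⟩

theorem integrableOn_potential (hd : 1 ≤ d) (hV : IsAdmissible d V) (a b : ℝ) :
    IntegrableOn V (annulus d a b) (extMeasure d) := by
  obtain ⟨M, -, hM⟩ := density_le hd hV
  refine integrableOn_of_nonneg_of_le hV.aemeasurable (M := M) ?_ a b
  filter_upwards [hM, hV.pos] with x h1 h2
  exact ⟨h2.le, h1.1⟩

theorem mass_nonneg (hV : IsAdmissible d V) (a b : ℝ) : 0 ≤ mass V a b :=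
  setIntegral_nonneg_of_ae_restrict (ae_restrict_of_ae ((density_pos hV).mono fun _ h => h.le))

theorem mass_add (hd : 1 ≤ d) (hV : IsAdmissible d V) {a b c : ℝ} (hab : a ≤ b) (hbc : b ≤ c) :
    mass V a b + mass V b c = mass V a c := by
  rw [mass, mass, mass, ← annulus_union hab hbc, setIntegral_union (disjoint_annulus le_rfl)
    (measurableSet_annulus _ _) (integrableOn_density hd hV _ _) (integrableOn_density hd hV _ _)]

/-- The mass in terms of the Lebesgue integral of nonnegative functions. -/
theorem ofReal_mass (hd : 1 ≤ d) (hV : IsAdmissible d V) {a b : ℝ} (ha : 1 ≤ a) :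
    ENNReal.ofReal (mass V a b) =
      ∫⁻ x in annulus d a b, ENNReal.ofReal (V x * ‖x‖ ^ (1 - (d : ℝ))) := by
  rw [mass, ofReal_integral_eq_lintegral_ofReal (integrableOn_density hd hV a b)
    (ae_restrict_of_ae ((density_pos hV).mono fun _ h => h.le)), extMeasure_annulus ha]

/-- The volume of an annulus which lies in `|x| ≤ 3 r` and has thickness at most `3 l`. -/
theorem volume_annulus_le_of_le (hd : 1 ≤ d) {a b r l : ℝ} (ha : 1 ≤ a) (hab : a ≤ b)
    (hb : b ≤ 3 * r) (hl : b - a ≤ 3 * l) (hr : 0 ≤ r) :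
    (extMeasure d).real (annulus d a b) ≤ annulusConst d * r ^ (d - 1) * l := by
  rw [extMeasure_real_annulus ha]
  refine (volume_annulus_le hd (by linarith) hab).trans ?_
  set β := volume.real (Metric.ball (0 : EuclideanSpace ℝ (Fin d)) 1) with hβ
  have h3 : 0 ≤ β := measureReal_nonneg
  have hb0 : 0 ≤ b := by linarith
  have hl0 : 0 ≤ b - a := by linarith
  calc β * d * b ^ (d - 1) * (b - a) ≤ β * d * (3 * r) ^ (d - 1) * (3 * l) := by gcongr
    _ = annulusConst d * r ^ (d - 1) * l := by
      obtain ⟨n, rfl⟩ : ∃ n, d = n + 1 := ⟨d - 1, by omega⟩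
      rw [annulusConst, mul_pow, Nat.add_sub_cancel, pow_succ (3 : ℝ)]
      ring

/-- The mass of an annulus is at most proportional to its thickness, with a constant depending
on `V`. -/
theorem exists_mass_le (hd : 1 ≤ d) (hV : IsAdmissible d V) :
    ∃ M, 0 < M ∧ ∀ a b, 1 ≤ a → a ≤ b → b ≤ 2 * a → mass V a b ≤ M * (b - a) := by
  obtain ⟨M, hM0, hM⟩ := density_le hd hV
  have hC := annulusConst_pos hd
  refine ⟨(M + 1) * annulusConst d, by positivity, fun a b ha hab hb => ?_⟩
  have hvol : (extMeasure d).real (annulus d a b) ≤ annulusConst d * a ^ (d - 1) * (b - a) :=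
    volume_annulus_le_of_le hd ha hab (by linarith) (by linarith) (by linarith)
  have hfin : extMeasure d (annulus d a b) < ⊤ :=
    (Measure.restrict_apply_le _ _).trans_lt (volume_annulus_lt_top a b)
  have ha0 : 0 < a := by linarith
  have h1 : mass V a b ≤ ∫ x in annulus d a b, M * (a ^ (d - 1))⁻¹ ∂(extMeasure d) := by
    refine setIntegral_mono_on_ae (integrableOn_density hd hV a b)
      (integrableOn_const hfin.ne) (measurableSet_annulus a b) ?_
    filter_upwards [hM, hV.pos] with x hx h0 hxa
    have h3 := rpow_one_sub_le hd ha0 hxa.1.le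
    have h5 : 0 ≤ ‖x‖ ^ (1 - (d : ℝ)) := by positivity
    gcongr
    exact hx.1
  rw [setIntegral_const, smul_eq_mul] at h1
  have h2 : 0 ≤ b - a := by linarith
  calc mass V a b ≤ (annulusConst d * a ^ (d - 1) * (b - a)) * (M * (a ^ (d - 1))⁻¹) := by
        refine h1.trans ?_
        gcongr
    _ = (M * annulusConst d) * (b - a) := by field_simp
    _ ≤ _ := by gcongr; linarith

/-- Without the weight the potential has at least `a ^ (d - 1)` times the mass. -/
theorem mass_mul_le (hd : 1 ≤ d) (hV : IsAdmissible d V) {a b : ℝ} (ha : 1 ≤ a) :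
    a ^ (d - 1) * mass V a b ≤ ∫ x in annulus d a b, V x ∂(extMeasure d) := by
  rw [mass, ← integral_const_mul]
  refine setIntegral_mono_on_ae ((integrableOn_density hd hV a b).const_mul _)
    (integrableOn_potential hd hV a b) (measurableSet_annulus a b) ?_
  filter_upwards [hV.pos] with x h0 hxa
  have hx : 0 < ‖x‖ := by linarith [hxa.1]
  have h1 : ‖x‖ ^ (d - 1) * ‖x‖ ^ (1 - (d : ℝ)) = 1 := by
    rw [← Real.rpow_natCast, ← Real.rpow_add hx, Nat.cast_sub hd]
    simp
  have h2 : a ^ (d - 1) ≤ ‖x‖ ^ (d - 1) := by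
    have := hxa.1.le
    gcongr
  have h3 : 0 ≤ ‖x‖ ^ (1 - (d : ℝ)) := by positivity
  calc a ^ (d - 1) * (V x * ‖x‖ ^ (1 - (d : ℝ)))
      ≤ ‖x‖ ^ (d - 1) * (V x * ‖x‖ ^ (1 - (d : ℝ))) := by gcongr
    _ = V x * (‖x‖ ^ (d - 1) * ‖x‖ ^ (1 - (d : ℝ))) := by ring
    _ = V x := by rw [h1, mul_one]

end Annulus

/-! ### Radial trapezoidal test functions -/

section Bump

variable {d : ℕ} {V : EuclideanSpace ℝ (Fin d) → ℝ}

/-- The radial trapezoidal function which is `1` on `a ≤ |x| ≤ b` and decays with slope `k`. -/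
noncomputable def bump (d : ℕ) (a b : ℝ) (k : ℝ≥0) (x : EuclideanSpace ℝ (Fin d)) : ℝ :=
  max 0 (min 1 (1 - k * max (a - ‖x‖) (‖x‖ - b)))

theorem lipschitzWith_bump (a b : ℝ) (k : ℝ≥0) : LipschitzWith k (bump d a b k) := by
  refine LipschitzWith.const_max (LipschitzWith.const_min ?_ 1) 0
  refine LipschitzWith.of_dist_le_mul fun x y => ?_
  have h1 : |max (a - ‖x‖) (‖x‖ - b) - max (a - ‖y‖) (‖y‖ - b)| ≤ ‖x - y‖ := by
    refine (abs_max_sub_max_le_max _ _ _ _).trans (max_le ?_ ?_)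
    · rw [sub_sub_sub_cancel_left, abs_sub_comm]
      exact abs_norm_sub_norm_le x y
    · rw [sub_sub_sub_cancel_right]
      exact abs_norm_sub_norm_le x y
  rw [Real.dist_eq, dist_eq_norm, sub_sub_sub_cancel_left, ← mul_sub, abs_mul, NNReal.abs_eq,
    abs_sub_comm]
  gcongr

theorem bump_nonneg (a b : ℝ) (k : ℝ≥0) (x : EuclideanSpace ℝ (Fin d)) : 0 ≤ bump d a b k x :=
  le_max_left _ _

theorem bump_le_one (a b : ℝ) (k : ℝ≥0) (x : EuclideanSpace ℝ (Fin d)) : bump d a b k x ≤ 1 :=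
  max_le zero_le_one (min_le_left _ _)

theorem bump_eq_one {a b : ℝ} (k : ℝ≥0) {x : EuclideanSpace ℝ (Fin d)} (ha : a ≤ ‖x‖)
    (hb : ‖x‖ ≤ b) : bump d a b k x = 1 := by
  have h : max (a - ‖x‖) (‖x‖ - b) ≤ 0 := max_le (by linarith) (by linarith)
  have h2 := mul_nonpos_of_nonneg_of_nonpos k.2 h
  have h3 : (1 : ℝ) ≤ 1 - k * max (a - ‖x‖) (‖x‖ - b) := by
    change (k : ℝ) * _ ≤ 0 at h2
    linarith
  rw [bump, min_eq_left h3, max_eq_right zero_le_one]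

theorem bump_eq_zero {a b : ℝ} {k : ℝ≥0} (hk : 0 < k) {x : EuclideanSpace ℝ (Fin d)}
    (h : ‖x‖ ≤ a - (k : ℝ)⁻¹ ∨ b + (k : ℝ)⁻¹ ≤ ‖x‖) : bump d a b k x = 0 := by
  have h1 : (k : ℝ)⁻¹ ≤ max (a - ‖x‖) (‖x‖ - b) := by
    rcases h with h | h
    · exact le_max_of_le_left (by linarith)
    · exact le_max_of_le_right (by linarith)
  have hk' : (0 : ℝ) < k := hk
  have h2 : 1 ≤ k * max (a - ‖x‖) (‖x‖ - b) := by
    calc (1 : ℝ) = k * (k : ℝ)⁻¹ := by field_simp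
      _ ≤ _ := by gcongr
  exact max_eq_left ((min_le_right _ _).trans (by linarith))

theorem hasCompactSupport_bump (a b : ℝ) {k : ℝ≥0} (hk : 0 < k) :
    HasCompactSupport (bump d a b k) := by
  refine HasCompactSupport.intro (isCompact_closedBall 0 (b + (k : ℝ)⁻¹)) fun x hx => ?_
  refine bump_eq_zero hk (Or.inr ?_)
  simp only [Metric.mem_closedBall, dist_zero_right, not_le] at hx
  exact hx.le

/-- The trapezoidal test function with plateau `(a, a + l]` and slope `K / l`, as an element of
the form domain. -/
noncomputable def bumpElement (d : ℕ) (a l : ℝ) {k : ℝ≥0} (hk : 0 < k) : formDomain d :=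
  lipschitzElement (lipschitzWith_bump a (a + l) k) (hasCompactSupport_bump a (a + l) hk)

theorem bumpElement_bounds (hd : 1 ≤ d) (hV : IsAdmissible d V) {a l K : ℝ} (ha : 1 ≤ a)
    (hl : 0 < l) (hla : l ≤ a) (hK : 1 ≤ K) {k : ℝ≥0} (hk : 0 < k) (hkl : (k : ℝ) = K / l) :
    ‖formInclusion d (bumpElement d a l hk)‖ ^ 2 ≤ annulusConst d * a ^ (d - 1) * l ∧
    (schrodingerForm hV (bumpElement d a l hk) (bumpElement d a l hk)).re ≤
      a ^ (d - 1) * (d * K ^ 2 * annulusConst d / l - mass V a (a + l)) := by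
  have hk1 : (k : ℝ)⁻¹ ≤ l := by
    rw [hkl, inv_div]
    exact div_le_self hl.le hK
  have hk0 : (0 : ℝ) < (k : ℝ)⁻¹ := inv_pos.2 hk
  set B := annulus d (max 1 (a - (k : ℝ)⁻¹)) (a + l + (k : ℝ)⁻¹) with hB
  have hBvol : (extMeasure d).real B ≤ annulusConst d * a ^ (d - 1) * l := by
    refine volume_annulus_le_of_le hd (le_max_left _ _) (max_le ?_ ?_) ?_ ?_ ?_
    · linarith
    · linarith
    · linarith
    · have := le_max_right 1 (a - (k : ℝ)⁻¹)
      linarith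
    · linarith
  obtain ⟨h1, h2⟩ := cutoff_bounds hV (lipschitzWith_bump a (a + l) k)
    (hasCompactSupport_bump a (a + l) hk) (bump_nonneg a (a + l) k) (bump_le_one a (a + l) k)
    (measurableSet_annulus a (a + l)) (B := B) (measurableSet_annulus _ _)
    ((Measure.restrict_apply_le _ _).trans_lt (volume_annulus_lt_top _ _)).ne
    (fun x hx => bump_eq_one k hx.1.le hx.2) (fun x hx hxB => by
      have hx1 : 1 < ‖x‖ := hx
      refine bump_eq_zero hk ?_
      by_contra! hc
      exact hxB ⟨max_lt hx1 hc.1, hc.2.le⟩)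
  refine ⟨h1.trans hBvol, h2.trans ?_⟩
  have h3 := mass_mul_le hd hV (b := a + l) ha
  have h4 : d * (k : ℝ) ^ 2 * (extMeasure d).real B ≤
      d * (k : ℝ) ^ 2 * (annulusConst d * a ^ (d - 1) * l) := by gcongr
  have h5 : d * (k : ℝ) ^ 2 * (annulusConst d * a ^ (d - 1) * l) =
      a ^ (d - 1) * (d * K ^ 2 * annulusConst d / l) := by
    rw [hkl]
    field_simp
  rw [mul_sub]
  linarith

/-- If the mass of `(a, a + l]` exceeds the critical value by `D κ l`, then the form of the test
function is at most `-κ`. -/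
theorem bumpElement_le (hd : 1 ≤ d) (hV : IsAdmissible d V) {a l K κ : ℝ} (ha : 1 ≤ a)
    (hl : 0 < l) (hla : l ≤ a) (hK : 1 ≤ K) (hκ : 0 < κ) {k : ℝ≥0} (hk : 0 < k)
    (hkl : (k : ℝ) = K / l)
    (hm : d * K ^ 2 * annulusConst d / l + annulusConst d * κ * l ≤ mass V a (a + l)) :
    formInclusion d (bumpElement d a l hk) ≠ 0 ∧
    (schrodingerForm hV (bumpElement d a l hk) (bumpElement d a l hk)).re ≤
      -κ * ‖formInclusion d (bumpElement d a l hk)‖ ^ 2 := by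
  obtain ⟨h1, h2⟩ := bumpElement_bounds hd hV ha hl hla hK hk hkl
  have ha0 : 0 < a ^ (d - 1) := by positivity
  have hC := annulusConst_pos hd
  have h3 : a ^ (d - 1) * (d * K ^ 2 * annulusConst d / l - mass V a (a + l)) ≤
      a ^ (d - 1) * (-(annulusConst d * κ * l)) := by
    gcongr
    linarith
  have h4 : κ * ‖formInclusion d (bumpElement d a l hk)‖ ^ 2 ≤
      κ * (annulusConst d * a ^ (d - 1) * l) := by gcongr
  -- The form is negative at this element, so its `L²` norm cannot vanish.
  refine ⟨fun h0 => ?_, by linarith⟩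
  obtain ⟨M, hM⟩ := exists_isFormOperator_schrodinger hV
  have h5 := hM.lower (bumpElement d a l hk)
  rw [h0] at h5
  simp only [norm_zero] at h5
  have h6 : 0 < a ^ (d - 1) * (annulusConst d * κ * l) := by positivity
  linarith

/-- Annuli of critical mass, with neighbourhoods which do not overlap, each contribute an
eigenvalue of the order of the inverse square of their thickness. -/
theorem sum_inv_length_le (hd : 1 ≤ d) (hV : IsAdmissible d V) {K p : ℝ} (hK : 1 ≤ K) (hp : 0 < p)
    (I : Finset ℕ) (a l : ℕ → ℝ) (ha : ∀ i ∈ I, 1 ≤ a i) (hl : ∀ i ∈ I, 0 < l i)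
    (hla : ∀ i ∈ I, l i ≤ a i)
    (hm : ∀ i ∈ I, (d * K ^ 2 + 1) * annulusConst d / l i ≤ mass V (a i) (a i + l i))
    (hsep : ∀ i ∈ I, ∀ k ∈ I, i < k → a i + l i + l i / K ≤ a k - l k / K) :
    ∑ i ∈ I, ENNReal.ofReal (l i ^ (-(2 * p))) ≤ negEigenvalueSum (schrodinger d V) p := by
  obtain ⟨M, hM⟩ := exists_isFormOperator_schrodinger hV
  have hKl : ∀ i ∈ I, 0 < K / l i := fun i hi => div_pos (by linarith) (hl i hi)
  let s : ℕ → ℝ≥0 := fun i => if 0 < K / l i then (K / l i).toNNReal else 1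
  have hs : ∀ i, 0 < s i := by
    intro i
    by_cases h : 0 < K / l i
    · simp [s, h]
    · simp [s, h]
  have hsK : ∀ i ∈ I, (s i : ℝ) = K / l i := by
    intro i hi
    simp [s, hKl i hi, (hKl i hi).le]
  have hκ : ∀ i ∈ I, 0 < (l i ^ 2)⁻¹ := fun i hi => by have := hl i hi; positivity
  have hbump : ∀ i ∈ I, _ := fun i hi => bumpElement_le hd hV (ha i hi) (hl i hi) (hla i hi) hK
    (hκ i hi) (hs i) (hsK i hi) (by
      refine le_trans (le_of_eq ?_) (hm i hi)
      have := hl i hi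
      field_simp)
  have hzero : ∀ i ∈ I, ∀ k ∈ I, i ≠ k → ∀ x : EuclideanSpace ℝ (Fin d),
      bump d (a i) (a i + l i) (s i) x = 0 ∨ bump d (a k) (a k + l k) (s k) x = 0 := by
    have aux : ∀ i ∈ I, ∀ k ∈ I, i < k → ∀ x : EuclideanSpace ℝ (Fin d),
        bump d (a i) (a i + l i) (s i) x = 0 ∨ bump d (a k) (a k + l k) (s k) x = 0 := by
      intro i hi k hk hik x
      have h1 := hsep i hi k hk hik
      have h2 : ((s i : ℝ))⁻¹ = l i / K := by rw [hsK i hi, inv_div]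
      have h3 : ((s k : ℝ))⁻¹ = l k / K := by rw [hsK k hk, inv_div]
      rcases le_total ‖x‖ (a k - l k / K) with h | h
      · exact Or.inr (bump_eq_zero (hs k) (Or.inl (by rw [h3]; exact h)))
      · exact Or.inl (bump_eq_zero (hs i) (Or.inr (by rw [h2]; linarith)))
    intro i hi k hk hik x
    rcases lt_or_gt_of_ne hik with h | h
    · exact aux i hi k hk h x
    · exact (aux k hk i hi h x).symm
  have h := hM.sum_rpow_le hV.discrete I (fun i => bumpElement d (a i) (l i) (hs i))
    (fun i => (l i ^ 2)⁻¹) hκ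
    (fun i hi k hk hik => inner_lipschitzElement_eq_zero _ _ _ _ (hzero i hi k hk hik))
    (fun i hi k hk hik => schrodingerForm_lipschitzElement_eq_zero _ _ _ _ hV
      (bump_nonneg _ _ _) (bump_nonneg _ _ _) (hzero i hi k hk hik))
    (fun i hi => (hbump i hi).1) (fun i hi => (hbump i hi).2) hp
  refine le_trans (le_of_eq (Finset.sum_congr rfl fun i hi => ?_)) h
  congr 1
  rw [← Real.rpow_natCast, ← Real.rpow_neg (hl i hi).le, ← Real.rpow_mul (hl i hi).le]
  congr 1
  push_cast
  ring

/-- The lowest eigenvalue bounds the mass of every annulus of thickness one. -/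
theorem mass_unit_le (hd : 1 ≤ d) (hV : IsAdmissible d V) {a : ℝ} (ha : 1 ≤ a) :
    mass V a (a + 1) ≤ annulusConst d * (d + 1 + |lowestEigenvalue (schrodinger d V)|) := by
  -- Otherwise the test function gives an eigenvalue at or below `-(1 + |λ₀|)`.
  by_contra! hc
  obtain ⟨M, hM⟩ := exists_isFormOperator_schrodinger hV
  set κ := 1 + |lowestEigenvalue (schrodinger d V)| with hκ
  have hκ0 : 0 < κ := by positivity
  obtain ⟨h1, h2⟩ := bumpElement_le hd hV ha one_pos ha le_rfl hκ0 (k := 1) one_pos (by simp)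
    (by rw [hκ]; linarith)
  have h3 := hM.lowestEigenvalue_le hV.discrete hκ0 h1 h2
  have h4 := neg_abs_le (lowestEigenvalue (schrodinger d V))
  linarith

end Bump

/-! ### Critical partitions -/

section Partition

variable {d : ℕ} {V : EuclideanSpace ℝ (Fin d) → ℝ}

/-- The greedy choice of an interval starting at `a`, by the intermediate value theorem. -/
theorem exists_critical_length (hd : 1 ≤ d) (hV : IsAdmissible d V) {c a : ℝ} (hc : 0 < c)
    (ha : 1 ≤ a) :
    ∃ l, 0 < l ∧ l ≤ a ∧ l * mass V a (a + l) ≤ c ∧ (l = a ∨ l * mass V a (a + l) = c) := by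
  have ha0 : 0 < a := by linarith
  rcases le_or_gt (a * mass V a (a + a)) c with h | h
  · exact ⟨a, ha0, le_rfl, h, Or.inl rfl⟩
  obtain ⟨M, hM, hmass⟩ := exists_mass_le hd hV
  have hlip : LipschitzOnWith M.toNNReal (fun l => mass V a (a + l)) (Set.Icc 0 a) := by
    refine LipschitzOnWith.of_le_add_mul _ fun x hx y hy => ?_
    rw [Real.coe_toNNReal _ hM.le]
    rcases le_total x y with hxy | hxy
    · have h1 := mass_add hd hV (a := a) (b := a + x) (c := a + y) (by linarith [hx.1])
        (by linarith)
      have h2 := mass_nonneg hV (a + x) (a + y)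
      have h3 : 0 ≤ M * dist x y := by positivity
      linarith
    · have h1 := mass_add hd hV (a := a) (b := a + y) (c := a + x) (by linarith [hy.1])
        (by linarith)
      have h2 := hmass (a + y) (a + x) (by linarith [hy.1]) (by linarith)
        (by linarith [hy.1, hx.2])
      rw [Real.dist_eq, abs_of_nonneg (sub_nonneg.2 hxy)]
      rw [add_sub_add_left_eq_sub] at h2
      linarith
  have hcont : ContinuousOn (fun l => l * mass V a (a + l)) (Set.Icc 0 a) :=
    continuousOn_id.mul hlip.continuousOn
  obtain ⟨l, hl, hlc⟩ := intermediate_value_Icc ha0.le hcont ⟨by simpa using hc.le, h.le⟩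
  have hlc' : l * mass V a (a + l) = c := hlc
  refine ⟨l, lt_of_le_of_ne hl.1 ?_, hl.2, hlc'.le, Or.inr hlc'⟩
  rintro rfl
  rw [zero_mul] at hlc'
  exact hc.ne hlc'

/-- A partition of `(1, ∞)` into intervals `(rₙ, rₙ₊₁]`, of length at most `rₙ`, for which the
product of length and mass is at most `c`. Each interval is either critical, which means that
the product is equal to `c`, or long, which means that its length is `rₙ`. -/
structure IsCriticalPartition (V : EuclideanSpace ℝ (Fin d) → ℝ) (c : ℝ) (r : ℕ → ℝ) : Prop where
  zero : r 0 = 1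
  lt_succ : ∀ n, r n < r (n + 1)
  length_le : ∀ n, r (n + 1) - r n ≤ r n
  mul_mass_le : ∀ n, (r (n + 1) - r n) * mass V (r n) (r (n + 1)) ≤ c
  long_or_critical : ∀ n, r (n + 1) - r n = r n ∨
    (r (n + 1) - r n) * mass V (r n) (r (n + 1)) = c

theorem exists_criticalPartition (hd : 1 ≤ d) (hV : IsAdmissible d V) {c : ℝ} (hc : 0 < c) :
    ∃ r, IsCriticalPartition V c r := by
  have h : ∀ a : ℝ, 1 ≤ a → _ := fun a ha => exists_critical_length hd hV hc ha
  choose! L h1 h2 h3 h4 using h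
  let r : ℕ → ℝ := fun n => Nat.rec 1 (fun _ a => a + L a) n
  have hr : ∀ n, r (n + 1) = r n + L (r n) := fun n => rfl
  have hr1 : ∀ n, 1 ≤ r n := by
    intro n
    induction n with
    | zero => exact le_rfl
    | succ n ih =>
      have := h1 _ ih
      rw [hr]
      linarith
  have hL : ∀ n, r (n + 1) - r n = L (r n) := fun n => by rw [hr]; ring
  refine ⟨r, rfl, fun n => ?_, fun n => ?_, fun n => ?_, fun n => ?_⟩
  · have := h1 _ (hr1 n)
    rw [hr]
    linarith
  · rw [hL]
    exact h2 _ (hr1 n)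
  · rw [hL, hr]
    exact h3 _ (hr1 n)
  · rw [hL, hr]
    exact h4 _ (hr1 n)

variable {c : ℝ} {r : ℕ → ℝ}

theorem IsCriticalPartition.monotone (h : IsCriticalPartition V c r) : Monotone r :=
  monotone_nat_of_le_succ fun n => (h.lt_succ n).le

theorem IsCriticalPartition.one_le (h : IsCriticalPartition V c r) (n : ℕ) : 1 ≤ r n :=
  h.zero ▸ h.monotone (Nat.zero_le n)

theorem IsCriticalPartition.length_pos (h : IsCriticalPartition V c r) (n : ℕ) :
    0 < r (n + 1) - r n := sub_pos.2 (h.lt_succ n)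

theorem IsCriticalPartition.mass_le (h : IsCriticalPartition V c r) (n : ℕ) :
    mass V (r n) (r (n + 1)) ≤ c / (r (n + 1) - r n) := by
  rw [le_div_iff₀ (h.length_pos n), mul_comm]
  exact h.mul_mass_le n

/-- A bound for the mass of the annuli of thickness at most one gives a lower bound for the lengths
of the intervals. -/
theorem IsCriticalPartition.min_le_length (h : IsCriticalPartition V c r) (hc : 0 < c) {B : ℝ}
    (hB : ∀ a b, 1 ≤ a → a ≤ b → b ≤ a + 1 → mass V a b ≤ B) (n : ℕ) :
    min 1 (c / B) ≤ r (n + 1) - r n := by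
  have h0 := h.length_pos n
  rcases le_or_gt 1 (r (n + 1) - r n) with h1 | h1
  · exact (min_le_left _ _).trans h1
  · have h2 := (h.long_or_critical n).resolve_left fun h3 => by
      have := h.one_le n
      linarith
    have h3 := hB (r n) (r (n + 1)) (h.one_le n) (h.lt_succ n).le (by linarith)
    have h4 : c ≤ (r (n + 1) - r n) * B := by rw [← h2]; gcongr
    have hB0 : 0 < B := by
      by_contra! hB0
      have := mul_nonpos_of_nonneg_of_nonpos h0.le hB0
      linarith
    exact (min_le_right _ _).trans ((div_le_iff₀ hB0).2 h4)

theorem IsCriticalPartition.exists_length_ge (h : IsCriticalPartition V c r) (hd : 1 ≤ d)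
    (hV : IsAdmissible d V) (hc : 0 < c) : ∃ η, 0 < η ∧ ∀ n, η ≤ r (n + 1) - r n := by
  obtain ⟨M, hM, hmass⟩ := exists_mass_le hd hV
  refine ⟨min 1 (c / M), lt_min one_pos (div_pos hc hM), h.min_le_length hc fun a b ha hab hb => ?_⟩
  refine (hmass a b ha hab (by linarith)).trans ?_
  calc M * (b - a) ≤ M * 1 := by gcongr; linarith
    _ = M := mul_one M

theorem add_mul_le_of_length_ge {η : ℝ} (h : ∀ n, η ≤ r (n + 1) - r n) (n k : ℕ) :
    r n + k * η ≤ r (n + k) := by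
  induction k with
  | zero => simp
  | succ k ih =>
    have := h (n + k)
    rw [← add_assoc]
    push_cast
    linarith

theorem IsCriticalPartition.exists_mem (h : IsCriticalPartition V c r) (hd : 1 ≤ d)
    (hV : IsAdmissible d V) (hc : 0 < c) {x : EuclideanSpace ℝ (Fin d)} (hx : 1 < ‖x‖) :
    ∃ n, x ∈ annulus d (r n) (r (n + 1)) := by
  obtain ⟨η, hη, hr⟩ := h.exists_length_ge hd hV hc
  have hex : ∃ n, ‖x‖ ≤ r n := by
    obtain ⟨k, hk⟩ := exists_nat_gt (‖x‖ / η)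
    refine ⟨k, ?_⟩
    have h1 := add_mul_le_of_length_ge hr 0 k
    rw [h.zero, zero_add] at h1
    rw [div_lt_iff₀ hη] at hk
    linarith
  classical
  obtain ⟨n, hn⟩ : ∃ n, Nat.find hex = n + 1 := by
    refine Nat.exists_eq_succ_of_ne_zero fun h0 => ?_
    have := Nat.find_spec hex
    rw [h0, h.zero] at this
    linarith
  refine ⟨n, not_le.1 (Nat.find_min hex (m := n) (by omega)), ?_⟩
  rw [← hn]
  exact Nat.find_spec hex

/-- If each term is dominated by `g n` and a quarter of the sum of its two neighbours, then the sum
is dominated by that of `g`. Boundedness excludes exponentially growing solutions. -/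
theorem tsum_le_two_mul_of_neighbours {a g : ℕ → ℝ≥0∞} {B : ℝ≥0∞} (hB : B ≠ ⊤)
    (haB : ∀ n, a n ≤ B)
    (h : ∀ n, a n ≤ g n + (a (n + 1) + if n = 0 then 0 else a (n - 1)) / 4) :
    ∑' n, a n ≤ 2 * ∑' n, g n := by
  by_cases hg : ∑' n, g n = ⊤
  · simp [hg]
  have h4 : ∀ x : ℝ≥0∞, (x + x) / 4 = x / 2 := by
    intro x
    rw [← two_mul, ENNReal.div_eq_inv_mul, ENNReal.div_eq_inv_mul, ← mul_assoc]
    congr 1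
    rw [show (4 : ℝ≥0∞) = 2 * 2 by norm_num, ENNReal.mul_inv (by simp) (by simp), mul_assoc,
      ENNReal.inv_mul_cancel (by simp) (by simp), mul_one]
  have habsorb : ∀ x y : ℝ≥0∞, x ≠ ⊤ → x ≤ y + x / 2 → x ≤ 2 * y := by
    intro x y hx hxy
    have hx2 : x / 2 ≠ ⊤ := ENNReal.div_ne_top hx (by simp)
    have h1 : x / 2 ≤ y := by
      refine (ENNReal.add_le_add_iff_right hx2).1 ?_
      rwa [ENNReal.add_halves]
    calc x = x / 2 + x / 2 := (ENNReal.add_halves x).symm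
      _ ≤ y + y := add_le_add h1 h1
      _ = 2 * y := (two_mul y).symm
  -- The last neighbour in a partial sum is not absorbed, but it is at most `B`. This shows that the
  -- whole sum is finite, which permits absorbing without a boundary term.
  have hpartial : ∀ N, ∑ n ∈ Finset.range N, a n ≤ 2 * (∑' n, g n + B) := by
    intro N
    set P := ∑ n ∈ Finset.range N, a n with hP
    have hPtop : P ≠ ⊤ := by
      rw [hP]
      exact (ENNReal.sum_lt_top.2 fun n _ => (haB n).trans_lt hB.lt_top).ne
    refine habsorb P _ hPtop ?_
    have h1 : ∑ n ∈ Finset.range N, a (n + 1) ≤ P + B := by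
      calc ∑ n ∈ Finset.range N, a (n + 1) ≤ ∑ n ∈ Finset.range (N + 1), a n := by
            rw [Finset.sum_range_succ']
            exact le_self_add
        _ ≤ P + B := by
            rw [Finset.sum_range_succ]
            gcongr
            exact haB N
    have h2 : ∑ n ∈ Finset.range N, (if n = 0 then 0 else a (n - 1)) ≤ P := by
      cases N with
      | zero => simp
      | succ N =>
        rw [Finset.sum_range_succ', hP, Finset.sum_range_succ]
        simp
    calc P ≤ ∑ n ∈ Finset.range N, (g n + (a (n + 1) + if n = 0 then 0 else a (n - 1)) / 4) :=
          Finset.sum_le_sum fun n _ => h n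
      _ = ∑ n ∈ Finset.range N, g n + (∑ n ∈ Finset.range N, a (n + 1) +
            ∑ n ∈ Finset.range N, (if n = 0 then 0 else a (n - 1))) / 4 := by
          simp only [ENNReal.div_eq_inv_mul]
          rw [Finset.sum_add_distrib, ← Finset.mul_sum, Finset.sum_add_distrib]
      _ ≤ ∑' n, g n + ((P + B) + (P + B)) / 4 := by
          gcongr
          · exact ENNReal.sum_le_tsum _
          · exact h2.trans le_self_add
      _ = ∑' n, g n + (P / 2 + B / 2) := by rw [h4, ENNReal.add_div]
      _ ≤ ∑' n, g n + (P / 2 + B) := by gcongr; exact ENNReal.half_le_self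
      _ = ∑' n, g n + B + P / 2 := by ring
  have hfin : ∑' n, a n ≠ ⊤ := by
    refine ((ENNReal.tsum_le_of_sum_range_le hpartial).trans_lt ?_).ne
    exact ENNReal.mul_lt_top (by simp) (ENNReal.add_lt_top.2 ⟨lt_top_iff_ne_top.2 hg, hB.lt_top⟩)
  refine habsorb _ _ hfin ?_
  have h1 : ∑' n, a (n + 1) ≤ ∑' n, a n :=
    ENNReal.tsum_comp_le_tsum_of_injective (add_left_injective 1) a
  have h2 : ∑' n, (if n = 0 then 0 else a (n - 1)) = ∑' n, a n := by
    rw [tsum_eq_zero_add' ENNReal.summable]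
    simp
  calc ∑' n, a n ≤ ∑' n, (g n + (a (n + 1) + if n = 0 then 0 else a (n - 1)) / 4) :=
        ENNReal.tsum_le_tsum h
    _ = ∑' n, g n + (∑' n, a (n + 1) + ∑' n, (if n = 0 then 0 else a (n - 1))) / 4 := by
        simp only [ENNReal.div_eq_inv_mul]
        rw [ENNReal.tsum_add, ENNReal.tsum_mul_left, ENNReal.tsum_add]
    _ ≤ ∑' n, g n + (∑' n, a n + ∑' n, a n) / 4 := by
        rw [h2]
        gcongr
    _ = _ := by rw [h4]

/-- The long intervals contribute at most a geometric series, since `r` doubles along each. -/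
theorem IsCriticalPartition.tsum_long_le (h : IsCriticalPartition V c r) {p : ℝ} (hp : 0 < p) :
    ∑' n, (if r (n + 1) - r n = r n then
      ENNReal.ofReal ((r (n + 1) - r n) ^ (-(2 * p))) else 0) ≤
        ENNReal.ofReal (1 - 2 ^ (-(2 * p)))⁻¹ := by
  set q : ℝ := 2 ^ (-(2 * p)) with hq
  have hq1 : q < 1 := Real.rpow_lt_one_of_one_lt_of_neg (by norm_num) (by linarith)
  have hq2 : 0 < 1 - q := by linarith
  refine ENNReal.tsum_le_of_sum_range_le fun N => ?_
  have hterm : ∀ n, (if r (n + 1) - r n = r n then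
      ENNReal.ofReal ((r (n + 1) - r n) ^ (-(2 * p))) else 0) ≤
      ENNReal.ofReal ((1 - q)⁻¹ * (r n ^ (-(2 * p)) - r (n + 1) ^ (-(2 * p)))) := by
    intro n
    have h0 : 0 < r n := by linarith [h.one_le n]
    split_ifs with hl
    · refine ENNReal.ofReal_le_ofReal (le_of_eq ?_)
      have h2 : r (n + 1) = 2 * r n := by linarith
      rw [hl, h2, Real.mul_rpow (by norm_num) h0.le, ← hq]
      field_simp
    · exact zero_le
  have hanti : ∀ n, 0 ≤ (1 - q)⁻¹ * (r n ^ (-(2 * p)) - r (n + 1) ^ (-(2 * p))) := by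
    intro n
    have h0 : 0 < r n := by linarith [h.one_le n]
    have := Real.rpow_le_rpow_of_nonpos h0 (h.lt_succ n).le
      (by linarith : -(2 * p) ≤ 0)
    have h3 : 0 ≤ r n ^ (-(2 * p)) - r (n + 1) ^ (-(2 * p)) := by linarith
    positivity
  refine (Finset.sum_le_sum fun n _ => hterm n).trans ?_
  rw [← ENNReal.ofReal_sum_of_nonneg fun n _ => hanti n]
  refine ENNReal.ofReal_le_ofReal ?_
  rw [← Finset.mul_sum, Finset.sum_range_sub', h.zero, Real.one_rpow]
  have h0 : 0 < r N := by linarith [h.one_le N]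
  have h1 : 0 ≤ r N ^ (-(2 * p)) := by positivity
  calc (1 - q)⁻¹ * (1 - r N ^ (-(2 * p))) ≤ (1 - q)⁻¹ * 1 := by gcongr; linarith
    _ = _ := mul_one _

/-- The critical intervals which are not much longer than their neighbours contribute at most three
times the eigenvalue moment: every third of the test functions have disjoint supports. -/
theorem IsCriticalPartition.tsum_good_le (hd : 1 ≤ d) (hV : IsAdmissible d V) {K p : ℝ}
    (hK : 1 ≤ K) (hp : 0 < p)
    (h : IsCriticalPartition V ((d * K ^ 2 + 1) * annulusConst d) r) {G : Set ℕ}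
    [DecidablePred (· ∈ G)]
    (hcrit : ∀ n ∈ G, (r (n + 1) - r n) * mass V (r n) (r (n + 1)) =
      (d * K ^ 2 + 1) * annulusConst d)
    (hnext : ∀ n ∈ G, r (n + 1) - r n ≤ K * (r (n + 2) - r (n + 1)))
    (hprev : ∀ n, n + 1 ∈ G → r (n + 2) - r (n + 1) ≤ K * (r (n + 1) - r n)) :
    ∑' n, (if n ∈ G then ENNReal.ofReal ((r (n + 1) - r n) ^ (-(2 * p))) else 0) ≤
      3 * negEigenvalueSum (schrodinger d V) p := by
  have hK0 : 0 < K := by linarith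
  refine ENNReal.tsum_le_of_sum_range_le fun N => ?_
  rw [← Finset.sum_filter]
  set I := (Finset.range N).filter (· ∈ G) with hI
  have hclass : ∀ i ∈ Finset.range 3, ∑ n ∈ I.filter (fun n => n % 3 = i),
      ENNReal.ofReal ((r (n + 1) - r n) ^ (-(2 * p))) ≤
        negEigenvalueSum (schrodinger d V) p := by
    intro i _
    have hG : ∀ n ∈ I.filter (fun n => n % 3 = i), n ∈ G ∧ n % 3 = i := fun n hn =>
      ⟨(Finset.mem_filter.1 (Finset.mem_filter.1 hn).1).2, (Finset.mem_filter.1 hn).2⟩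
    refine sum_inv_length_le hd hV hK hp _ r (fun n => r (n + 1) - r n) (fun n _ => h.one_le n)
      (fun n _ => h.length_pos n) (fun n _ => h.length_le n) (fun n hn => ?_) fun m hm n hn hmn => ?_
    · rw [add_sub_cancel, ← hcrit n (hG n hn).1, mul_div_cancel_left₀ _ (h.length_pos n).ne']
    -- Both trapezoids stay on their side of the interval between `r (m + 2)` and `r k`.
    · obtain ⟨hmG, hm3⟩ := hG m hm
      obtain ⟨hnG, hn3⟩ := hG n hn
      obtain ⟨k, rfl⟩ : ∃ k, n = k + 1 := ⟨n - 1, by omega⟩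
      have h1 : (r (m + 1) - r m) / K ≤ r (m + 2) - r (m + 1) := by
        rw [div_le_iff₀ hK0, mul_comm]
        exact hnext m hmG
      have h2 : (r (k + 1 + 1) - r (k + 1)) / K ≤ r (k + 1) - r k := by
        rw [div_le_iff₀ hK0, mul_comm]
        exact hprev k hnG
      have h3 : r (m + 2) ≤ r k := h.monotone (by omega)
      linarith
  calc ∑ n ∈ I, ENNReal.ofReal ((r (n + 1) - r n) ^ (-(2 * p)))
      = ∑ i ∈ Finset.range 3, ∑ n ∈ I.filter (fun n => n % 3 = i),
          ENNReal.ofReal ((r (n + 1) - r n) ^ (-(2 * p))) :=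
        (Finset.sum_fiberwise_of_maps_to (fun n _ => Finset.mem_range.2 (Nat.mod_lt n (by omega)))
          _).symm
    _ ≤ ∑ _i ∈ Finset.range 3, negEigenvalueSum (schrodinger d V) p := Finset.sum_le_sum hclass
    _ = _ := by simp

/-- The central estimate: the eigenvalue moment controls the sum of the inverse lengths, to the
power `2 p`, of the intervals of a critical partition. -/
theorem IsCriticalPartition.tsum_length_le (hd : 1 ≤ d) (hV : IsAdmissible d V) {p : ℝ}
    (hp : 0 < p)
    (h : IsCriticalPartition V ((d * (2 ^ p⁻¹ : ℝ) ^ 2 + 1) * annulusConst d) r) :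
    ∑' n, ENNReal.ofReal ((r (n + 1) - r n) ^ (-(2 * p))) ≤
      (2 * (3 + (1 - 2 ^ (-(2 * p)) : ℝ)⁻¹.toNNReal) : ℝ≥0) *
        (1 + negEigenvalueSum (schrodinger d V) p) := by
  classical
  set K : ℝ := 2 ^ p⁻¹ with hK
  set S := negEigenvalueSum (schrodinger d V) p with hS
  have hK1 : 1 ≤ K := Real.one_le_rpow (by norm_num) (by positivity)
  have hK0 : 0 < K := by linarith
  have hKp : K ^ (-(2 * p)) = 1 / 4 := by
    rw [hK, ← Real.rpow_mul (by norm_num)]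
    have : p⁻¹ * -(2 * p) = -2 := by field_simp
    rw [this, Real.rpow_neg (by norm_num)]
    norm_num
  set l : ℕ → ℝ := fun n => r (n + 1) - r n with hl
  have hl0 : ∀ n, 0 < l n := h.length_pos
  have hc : 0 < (d * K ^ 2 + 1) * annulusConst d := by
    have := annulusConst_pos hd
    positivity
  obtain ⟨η, hη, hηl⟩ := h.exists_length_ge hd hV hc
  -- A quarter is gained by passing to a neighbour which is shorter by the factor `K = 2 ^ p⁻¹`.
  have hquarter : ∀ m n, K * l m < l n →
      ENNReal.ofReal (l n ^ (-(2 * p))) ≤ ENNReal.ofReal (l m ^ (-(2 * p))) / 4 := by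
    intro m n hmn
    have h1 : l n ^ (-(2 * p)) ≤ (K * l m) ^ (-(2 * p)) :=
      Real.rpow_le_rpow_of_nonpos (mul_pos hK0 (hl0 m)) hmn.le (by linarith)
    rw [Real.mul_rpow hK0.le (hl0 m).le, hKp] at h1
    have h2 : ENNReal.ofReal (l m ^ (-(2 * p))) / 4 =
        ENNReal.ofReal (1 / 4 * l m ^ (-(2 * p))) := by
      rw [one_div_mul_eq_div, ENNReal.ofReal_div_of_pos (by norm_num)]
      norm_num
    rw [h2]
    exact ENNReal.ofReal_le_ofReal h1
  let G : Set ℕ := {n | l n * mass V (r n) (r (n + 1)) = (d * K ^ 2 + 1) * annulusConst d ∧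
    l n ≤ K * l (n + 1) ∧ ∀ m, n = m + 1 → l n ≤ K * l m}
  have hgood := h.tsum_good_le hd hV hK1 hp (G := G) (fun n hn => hn.1) (fun n hn => hn.2.1)
    (fun n hn => hn.2.2 n rfl)
  have hlong := h.tsum_long_le hp
  have hmain : ∑' n, ENNReal.ofReal (l n ^ (-(2 * p))) ≤
      2 * ∑' n, ((if l n = r n then ENNReal.ofReal (l n ^ (-(2 * p))) else 0) +
        (if n ∈ G then ENNReal.ofReal (l n ^ (-(2 * p))) else 0)) := by
    refine tsum_le_two_mul_of_neighbours (B := ENNReal.ofReal (η ^ (-(2 * p))))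
      ENNReal.ofReal_ne_top (fun n => ?_) fun n => ?_
    · exact ENNReal.ofReal_le_ofReal
        (Real.rpow_le_rpow_of_nonpos hη (hηl n) (by linarith))
    by_cases h1 : l n = r n
    · rw [if_pos h1, add_assoc]
      exact le_self_add
    by_cases h2 : n ∈ G
    · rw [if_pos h2, add_comm (ite _ _ _), add_assoc]
      exact le_self_add
    refine le_trans ?_ le_add_self
    have hcr := (h.long_or_critical n).resolve_left h1
    have h3 : K * l (n + 1) < l n ∨ ∃ m, n = m + 1 ∧ K * l m < l n := by
      by_contra! h3
      exact h2 ⟨hcr, h3.1, h3.2⟩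
    rcases h3 with h3 | ⟨m, rfl, h3⟩
    · refine (hquarter _ _ h3).trans ?_
      gcongr
      exact le_self_add
    · refine (hquarter _ _ h3).trans ?_
      gcongr
      simp
  refine hmain.trans ?_
  rw [ENNReal.tsum_add]
  calc 2 * (_ + _) ≤ 2 * (ENNReal.ofReal (1 - 2 ^ (-(2 * p)))⁻¹ + 3 * S) := by gcongr
    _ ≤ 2 * (ENNReal.ofReal (1 - 2 ^ (-(2 * p)))⁻¹ * (1 + S) + 3 * (1 + S)) := by
      gcongr
      · exact le_mul_of_one_le_right' le_self_add
      · exact le_add_self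
    _ = _ := by
      push_cast
      rw [ENNReal.ofReal]
      ring

end Partition

/-! ### From critical partitions to weighted integrals -/

section Estimates

variable {d : ℕ} {V : EuclideanSpace ℝ (Fin d) → ℝ} {c : ℝ} {r : ℕ → ℝ}

theorem lintegral_weight_le (hd : 1 ≤ d) {a b : ℝ} (ha : 1 ≤ a) (hab : a ≤ b) (hb : b ≤ 2 * a) :
    ∫⁻ x in annulus d a b, ENNReal.ofReal (‖x‖ ^ (1 - (d : ℝ))) ≤
      ENNReal.ofReal (annulusConst d * (b - a)) := by
  have ha0 : 0 < a := by linarith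
  have h1 : ∫⁻ x in annulus d a b, ENNReal.ofReal (‖x‖ ^ (1 - (d : ℝ))) ≤
      ∫⁻ _x in annulus d a b, ENNReal.ofReal (a ^ (d - 1))⁻¹ :=
    setLIntegral_mono' (measurableSet_annulus a b) fun x hx =>
      ENNReal.ofReal_le_ofReal (rpow_one_sub_le hd ha0 hx.1.le)
  refine h1.trans ?_
  have h2 := volume_annulus_le_of_le (r := a) (l := b - a) hd ha hab (by linarith) (by linarith)
    ha0.le
  rw [extMeasure_real_annulus ha] at h2
  rw [setLIntegral_const, ← ENNReal.ofReal_toReal (volume_annulus_lt_top a b).ne,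
    ← ENNReal.ofReal_mul (by positivity)]
  refine ENNReal.ofReal_le_ofReal ?_
  calc (a ^ (d - 1))⁻¹ * volume.real (annulus d a b)
      ≤ (a ^ (d - 1))⁻¹ * (annulusConst d * a ^ (d - 1) * (b - a)) := by gcongr
    _ = annulusConst d * (b - a) := by field_simp

/-- Hölder's inequality on one interval of a critical partition. -/
theorem IsCriticalPartition.lintegral_rpow_le (hd : 1 ≤ d) (hV : IsAdmissible d V)
    (hc : 0 < c) (h : IsCriticalPartition V c r) {p : ℝ} (hp : 0 < p) (hp' : p ≤ 1 / 2) (n : ℕ) :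
    ∫⁻ x in annulus d (r n) (r (n + 1)),
        ENNReal.ofReal (|V x| ^ (1 / 2 + p) * ‖x‖ ^ (1 - (d : ℝ))) ≤
      ENNReal.ofReal (c ^ (1 / 2 + p) * annulusConst d ^ (1 / 2 - p)) *
        ENNReal.ofReal ((r (n + 1) - r n) ^ (-(2 * p))) := by
  have hr := h.one_le n
  have hl := h.length_pos n
  set l := r (n + 1) - r n with hldef
  have hC := annulusConst_pos hd
  have hpos : ∀ᵐ x ∂(volume.restrict (annulus d (r n) (r (n + 1)))), 0 < V x ∧ 0 < ‖x‖ := by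
    rw [← extMeasure_annulus hr]
    filter_upwards [ae_restrict_of_ae hV.pos,
      ae_restrict_of_ae (ae_restrict_mem isOpen_exterior.measurableSet)] with x h1 h2
    exact ⟨h1, zero_lt_one.trans h2⟩
  have hmeas : AEMeasurable (fun x => ENNReal.ofReal (V x * ‖x‖ ^ (1 - (d : ℝ))))
      (volume.restrict (annulus d (r n) (r (n + 1)))) := by
    rw [← extMeasure_annulus hr]
    exact (aemeasurable_density hV).restrict.ennreal_ofReal
  have hmeas' : AEMeasurable (fun x : EuclideanSpace ℝ (Fin d) =>
      ENNReal.ofReal (‖x‖ ^ (1 - (d : ℝ)))) (volume.restrict (annulus d (r n) (r (n + 1)))) :=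
    ((measurable_norm.pow_const _).ennreal_ofReal).aemeasurable
  -- `V ^ (1/2 + p) w = (V w) ^ (1/2 + p) w ^ (1/2 - p)` with `w = |x|^{1-d}`.
  have hH := ENNReal.lintegral_mul_norm_pow_le hmeas hmeas' (p := 1 / 2 + p) (q := 1 / 2 - p)
    (by linarith) (by linarith) (by ring)
  refine le_trans (le_of_eq (lintegral_congr_ae ?_)) (hH.trans ?_)
  · filter_upwards [hpos] with x ⟨h1, h2⟩
    have h3 : 0 < ‖x‖ ^ (1 - (d : ℝ)) := Real.rpow_pos_of_pos h2 _
    rw [ENNReal.ofReal_rpow_of_nonneg (by positivity) (by linarith),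
      ENNReal.ofReal_rpow_of_nonneg h3.le (by linarith), ← ENNReal.ofReal_mul (by positivity),
      abs_of_pos h1, Real.mul_rpow h1.le h3.le, mul_assoc, ← Real.rpow_add h3]
    norm_num
  · rw [← ofReal_mass hd hV hr]
    calc ENNReal.ofReal (mass V (r n) (r (n + 1))) ^ (1 / 2 + p) *
          (∫⁻ x in annulus d (r n) (r (n + 1)),
            ENNReal.ofReal (‖x‖ ^ (1 - (d : ℝ)))) ^ (1 / 2 - p)
        ≤ ENNReal.ofReal (c / l) ^ (1 / 2 + p) *
            ENNReal.ofReal (annulusConst d * l) ^ (1 / 2 - p) := by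
          gcongr ?_ ^ _ * ?_ ^ _
          · exact ENNReal.ofReal_le_ofReal (h.mass_le n)
          · exact lintegral_weight_le hd hr (h.lt_succ n).le (by linarith [h.length_le n])
      _ = _ := by
          rw [ENNReal.ofReal_rpow_of_nonneg (by positivity) (by linarith),
            ENNReal.ofReal_rpow_of_nonneg (by positivity) (by linarith),
            ← ENNReal.ofReal_mul (by positivity), ← ENNReal.ofReal_mul (by positivity)]
          congr 1
          have h1 : l ^ (-(2 * p)) = l ^ (-(1 / 2 + p)) * l ^ (1 / 2 - p) := by
            rw [← Real.rpow_add hl]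
            congr 1
            ring
          rw [Real.div_rpow hc.le hl.le, Real.mul_rpow hC.le hl.le, h1, Real.rpow_neg hl.le]
          field_simp

theorem IsCriticalPartition.lintegral_exterior_le (hd : 1 ≤ d) (hV : IsAdmissible d V)
    (hc : 0 < c) (h : IsCriticalPartition V c r) {p : ℝ} (hp : 0 < p) (hp' : p ≤ 1 / 2) :
    ∫⁻ x in {x : EuclideanSpace ℝ (Fin d) | 1 < ‖x‖},
        ENNReal.ofReal (|V x| ^ (1 / 2 + p) * ‖x‖ ^ (1 - (d : ℝ))) ≤
      ENNReal.ofReal (c ^ (1 / 2 + p) * annulusConst d ^ (1 / 2 - p)) *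
        ∑' n, ENNReal.ofReal ((r (n + 1) - r n) ^ (-(2 * p))) := by
  have hsub : {x : EuclideanSpace ℝ (Fin d) | 1 < ‖x‖} ⊆ ⋃ n, annulus d (r n) (r (n + 1)) :=
    fun x hx => Set.mem_iUnion.2 (h.exists_mem hd hV hc hx)
  refine (lintegral_mono_set hsub).trans ((lintegral_iUnion_le _ _).trans ?_)
  rw [← ENNReal.tsum_mul_left]
  exact ENNReal.tsum_le_tsum fun n => h.lintegral_rpow_le hd hV hc hp hp' n

/-- Superadditivity of `t ↦ t ^ q` for `1 ≤ q`, for infinite sums. -/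
theorem tsum_rpow_le_rpow_tsum (x : ℕ → ℝ≥0∞) {q : ℝ} (hq : 1 ≤ q) :
    ∑' n, x n ^ q ≤ (∑' n, x n) ^ q := by
  have h1 : ∀ y : ℝ≥0∞, y ^ q = y * y ^ (q - 1) := by
    intro y
    conv_lhs => rw [show q = 1 + (q - 1) by ring]
    rw [ENNReal.rpow_add_of_nonneg _ _ zero_le_one (by linarith), ENNReal.rpow_one]
  rw [h1 (∑' n, x n), ← ENNReal.tsum_mul_right]
  refine ENNReal.tsum_le_tsum fun n => ?_
  rw [h1]
  gcongr
  · exact ENNReal.le_tsum n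

/-- If the intervals of a partition have length at least `ρ`, then the masses of the unit annuli
are controlled by those of the partition: a unit interval meets a bounded number of intervals. -/
theorem IsCriticalPartition.tsum_unit_le (hd : 1 ≤ d) (hV : IsAdmissible d V)
    (hc : 0 < c) (h : IsCriticalPartition V c r) {ρ : ℝ} (hρ : 0 < ρ)
    (hlen : ∀ n, ρ ≤ r (n + 1) - r n) {p : ℝ} (hp : 1 / 2 ≤ p) :
    ∑' n : ℕ, (∫⁻ x in annulus d ((n : ℝ) + 1) ((n : ℝ) + 2),
        ENNReal.ofReal (V x * ‖x‖ ^ (1 - (d : ℝ)))) ^ (2 * p) ≤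
      ((⌈ρ⁻¹⌉₊ + 1 : ℕ) : ℝ≥0∞) ^ (2 * p - 1) * (ENNReal.ofReal (c ^ (2 * p)) *
        ∑' n, ENNReal.ofReal ((r (n + 1) - r n) ^ (-(2 * p)))) := by
  classical
  set N := ⌈ρ⁻¹⌉₊ with hN
  have hNρ : 1 ≤ N * ρ := by
    have h1 : ρ⁻¹ ≤ N := Nat.le_ceil _
    calc (1 : ℝ) = ρ⁻¹ * ρ := by field_simp
      _ ≤ N * ρ := by gcongr
  let ν : Measure (EuclideanSpace ℝ (Fin d)) :=
    volume.withDensity fun x => ENNReal.ofReal (V x * ‖x‖ ^ (1 - (d : ℝ)))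
  have hν : ∀ a b, ν (annulus d a b) =
      ∫⁻ x in annulus d a b, ENNReal.ofReal (V x * ‖x‖ ^ (1 - (d : ℝ))) := fun a b =>
    withDensity_apply _ (measurableSet_annulus a b)
  let U : ℕ → Set (EuclideanSpace ℝ (Fin d)) := fun n => annulus d ((n : ℝ) + 1) ((n : ℝ) + 2)
  let A : ℕ → Set (EuclideanSpace ℝ (Fin d)) := fun k => annulus d (r k) (r (k + 1))
  have hcover : ∀ n, ∃ k₀, U n ⊆ ⋃ k ∈ Finset.Ico k₀ (k₀ + (N + 1)), U n ∩ A k := by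
    intro n
    have hex : ∃ k, (n : ℝ) + 1 < r (k + 1) := by
      obtain ⟨m, hm⟩ := exists_nat_gt (((n : ℝ) + 1) / ρ)
      refine ⟨m, ?_⟩
      have h1 := add_mul_le_of_length_ge hlen 0 m
      rw [h.zero, zero_add] at h1
      rw [div_lt_iff₀ hρ] at hm
      have h2 := (h.lt_succ m).le
      linarith
    -- `k₀` is the first interval reaching beyond `n + 1`; `N ρ` is at least `1`.
    refine ⟨Nat.find hex, fun x hx => ?_⟩
    have hx1 : (n : ℝ) + 1 < ‖x‖ := hx.1
    have hx2 : ‖x‖ ≤ (n : ℝ) + 2 := hx.2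
    have hn0 : (0 : ℝ) ≤ n := Nat.cast_nonneg n
    obtain ⟨k, hk⟩ := h.exists_mem hd hV hc (x := x) (by linarith)
    refine Set.mem_iUnion₂.2 ⟨k, Finset.mem_Ico.2 ⟨?_, ?_⟩, hx, hk⟩
    · exact Nat.find_min' hex (hx1.trans_le hk.2)
    · by_contra! hge
      have h1 := add_mul_le_of_length_ge hlen (Nat.find hex + 1) N
      have h2 := h.monotone (show Nat.find hex + 1 + N ≤ k by omega)
      have h3 := Nat.find_spec hex
      have h4 := hk.1
      linarith
  have hU : ∀ n, ν (U n) ^ (2 * p) ≤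
      ((N + 1 : ℕ) : ℝ≥0∞) ^ (2 * p - 1) * ∑' k, ν (U n ∩ A k) ^ (2 * p) := by
    intro n
    obtain ⟨k₀, hk⟩ := hcover n
    calc ν (U n) ^ (2 * p)
        ≤ (∑ k ∈ Finset.Ico k₀ (k₀ + (N + 1)), ν (U n ∩ A k)) ^ (2 * p) := by
          gcongr
          · exact (measure_mono hk).trans (measure_biUnion_finset_le _ _)
      _ ≤ ((Finset.Ico k₀ (k₀ + (N + 1))).card : ℝ≥0∞) ^ (2 * p - 1) *
            ∑ k ∈ Finset.Ico k₀ (k₀ + (N + 1)), ν (U n ∩ A k) ^ (2 * p) :=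
          ENNReal.rpow_sum_le_const_mul_sum_rpow _ _ (by linarith)
      _ ≤ _ := by
          rw [Nat.card_Ico, Nat.add_sub_cancel_left]
          gcongr
          exact ENNReal.sum_le_tsum _
  have hA : ∀ k, ∑' n, ν (U n ∩ A k) ^ (2 * p) ≤
      ENNReal.ofReal (c ^ (2 * p)) * ENNReal.ofReal ((r (k + 1) - r k) ^ (-(2 * p))) := by
    intro k
    have hl := h.length_pos k
    have hmono : Pairwise (Function.onFun Disjoint fun n => U n ∩ A k) := by
      have aux : ∀ m n : ℕ, m < n → Disjoint (U m ∩ A k) (U n ∩ A k) := by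
        intro m n hmn
        have h1 : (m : ℝ) + 1 ≤ n := by exact_mod_cast hmn
        exact (disjoint_annulus (by linarith)).mono Set.inter_subset_left Set.inter_subset_left
      intro m n hmn
      rcases lt_or_gt_of_ne hmn with h1 | h1
      · exact aux m n h1
      · exact (aux n m h1).symm
    calc ∑' n, ν (U n ∩ A k) ^ (2 * p) ≤ (∑' n, ν (U n ∩ A k)) ^ (2 * p) :=
          tsum_rpow_le_rpow_tsum _ (by linarith)
      _ ≤ ν (A k) ^ (2 * p) := by
          rw [← measure_iUnion hmono fun n =>
            (measurableSet_annulus _ _).inter (measurableSet_annulus _ _)]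
          gcongr
          · exact Set.iUnion_subset fun n => Set.inter_subset_right
      _ ≤ ENNReal.ofReal (c / (r (k + 1) - r k)) ^ (2 * p) := by
          rw [hν, ← ofReal_mass hd hV (h.one_le k)]
          gcongr
          · exact h.mass_le k
      _ = _ := by
          rw [ENNReal.ofReal_rpow_of_nonneg (by positivity) (by linarith),
            ← ENNReal.ofReal_mul (by positivity), Real.div_rpow hc.le hl.le,
            Real.rpow_neg hl.le, div_eq_mul_inv]
  calc ∑' n : ℕ, (∫⁻ x in annulus d ((n : ℝ) + 1) ((n : ℝ) + 2),
        ENNReal.ofReal (V x * ‖x‖ ^ (1 - (d : ℝ)))) ^ (2 * p)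
      = ∑' n, ν (U n) ^ (2 * p) := by simp only [U, hν]
    _ ≤ ∑' n, ((N + 1 : ℕ) : ℝ≥0∞) ^ (2 * p - 1) * ∑' k, ν (U n ∩ A k) ^ (2 * p) :=
        ENNReal.tsum_le_tsum hU
    _ = ((N + 1 : ℕ) : ℝ≥0∞) ^ (2 * p - 1) * ∑' k, ∑' n, ν (U n ∩ A k) ^ (2 * p) := by
        rw [ENNReal.tsum_mul_left, ENNReal.tsum_comm]
    _ ≤ _ := by
        rw [← ENNReal.tsum_mul_left (a := ENNReal.ofReal (c ^ (2 * p)))]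
        exact mul_le_mul_right (ENNReal.tsum_le_tsum hA) _

end Estimates

end ExteriorNeumann

theorem theorem1p2 (d : ℕ) (hd : 1 ≤ d) :
    (∀ p : ℝ, 0 < p → p ≤ 1 / 2 →
      ∃ C : ℝ≥0, ∀ V : EuclideanSpace ℝ (Fin d) → ℝ, ExteriorNeumann.IsAdmissible d V →
        ∫⁻ x in {x : EuclideanSpace ℝ (Fin d) | 1 < ‖x‖},
            ENNReal.ofReal (|V x| ^ (1 / 2 + p) * ‖x‖ ^ (1 - (d : ℝ))) ≤
          C * (1 + ExteriorNeumann.negEigenvalueSum (ExteriorNeumann.schrodinger d V) p)) ∧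
    (∀ p : ℝ, 1 / 2 ≤ p →
      ∃ C : ℝ → ℝ≥0, ∀ V : EuclideanSpace ℝ (Fin d) → ℝ, ExteriorNeumann.IsAdmissible d V →
        ∑' n : ℕ, (∫⁻ x in {x : EuclideanSpace ℝ (Fin d) |
              (n : ℝ) + 1 < ‖x‖ ∧ ‖x‖ ≤ (n : ℝ) + 2},
            ENNReal.ofReal (V x * ‖x‖ ^ (1 - (d : ℝ)))) ^ (2 * p) ≤
          C (ExteriorNeumann.lowestEigenvalue (ExteriorNeumann.schrodinger d V)) *
            (1 + ExteriorNeumann.negEigenvalueSum (ExteriorNeumann.schrodinger d V) p)) := by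
  open ExteriorNeumann in
  have hD := annulusConst_pos hd
  have hc : ∀ p : ℝ, 0 < (d * (2 ^ p⁻¹ : ℝ) ^ 2 + 1) * annulusConst d := fun p => by positivity
  refine ⟨fun p hp hp' => ?_, fun p hp => ?_⟩
  · set c := (d * (2 ^ p⁻¹ : ℝ) ^ 2 + 1) * annulusConst d with hcdef
    refine ⟨(c ^ (1 / 2 + p) * annulusConst d ^ (1 / 2 - p)).toNNReal *
      (2 * (3 + (1 - 2 ^ (-(2 * p)) : ℝ)⁻¹.toNNReal)), fun V hV => ?_⟩
    obtain ⟨r, hr⟩ := exists_criticalPartition hd hV (hc p)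
    refine (hr.lintegral_exterior_le hd hV (hc p) hp hp').trans ?_
    rw [ENNReal.coe_mul, mul_assoc]
    exact mul_le_mul_right (hr.tsum_length_le hd hV hp) _
  · have hp0 : 0 < p := by linarith
    set c := (d * (2 ^ p⁻¹ : ℝ) ^ 2 + 1) * annulusConst d with hcdef
    let ρ : ℝ → ℝ := fun e => min 1 (c / (annulusConst d * (d + 1 + |e|)))
    have hρ : ∀ e, 0 < ρ e := fun e => lt_min one_pos (div_pos (hc p) (by positivity))
    refine ⟨fun e => ((⌈(ρ e)⁻¹⌉₊ + 1 : ℕ) : ℝ≥0) ^ (2 * p - 1) * ((c ^ (2 * p)).toNNReal *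
      (2 * (3 + (1 - 2 ^ (-(2 * p)) : ℝ)⁻¹.toNNReal))), fun V hV => ?_⟩
    obtain ⟨r, hr⟩ := exists_criticalPartition hd hV (hc p)
    set e := lowestEigenvalue (schrodinger d V) with he
    have hlen : ∀ n, ρ e ≤ r (n + 1) - r n := by
      refine hr.min_le_length (hc p) fun a b ha hab hb => ?_
      have h1 := mass_add hd hV hab hb
      have h2 := mass_nonneg hV b (a + 1)
      have h3 := mass_unit_le hd hV ha
      linarith
    refine (hr.tsum_unit_le hd hV (hc p) (hρ e) hlen hp).trans ?_
    rw [ENNReal.coe_mul, ENNReal.coe_mul, ENNReal.coe_rpow_of_nonneg _ (by linarith),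
      ENNReal.coe_natCast, mul_assoc, mul_assoc]
    exact mul_le_mul_right (mul_le_mul_right (hr.tsum_length_le hd hV hp0) _) _
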